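/- **Theorem 1.** The graph isomorphism problem is GI-complete for comparability graphs of posets with interval dimension $2$ and height $3$. That is, the following two decision problems are polynomial-time equivalent (each has a polynomial-time many-one reduction to the other): (i) given two finite simple graphs, decide whether they are isomorphic; (ii) given two finite simple graphs, each of which is a comparability graph of some finite poset of interval dimension $2$ and height $3$, decide whether they are isomorphic. Here the comparability graph of a finite poset $P=(X,\preceq)$ is the graph on $X$ in which distinct elements are adjacent exactly when they are comparable (taken up to isomorphism); the height of $P$ is the number of elements in a maximum chain; an interval order is a poset whose elements $x$ can be assigned closed real intervals $[l_x,r_x]$ such that $x\prec y$ if and only if $r_x<l_y$; and the interval dimension of $P$ is the minimum number $k$ of interval orders $\preceq_1,\dots,\preceq_k$ on $X$ such that $x\preceq y$ if and only if $x\preceq_i y$ for every $i$. -/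

import Mathlib

/-! ### Decision problems and polynomial-time many-one reductions -/

/-- A decision problem: a type of instances, their encoding as binary words, and the set of
yes-instances. Words that encode no instance are not inputs of the problem, so the restriction of a
problem to a class of instances is the problem with fewer instances and the same encoding. -/
structure DecisionProblem where
  /-- the admissible inputs -/
  Inst : Type
  /-- the word by which an input is presented to a Turing machine -/
  encode : Inst → List Bool
  /-- the question asked about an input -/
  IsYes : Inst → Prop

/-- `Q₁` reduces to `Q₂`: a function that a (multi-stack) Turing machine computes in time
polynomial in the length of the encoded input maps instances of `Q₁` to instances of `Q₂` and
preserves the answer. -/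
def DecisionProblem.PolyReducible (Q₁ Q₂ : DecisionProblem) : Prop :=
  ∃ f : Q₁.Inst → Q₂.Inst,
    Nonempty (Turing.TM2ComputableInPolyTime Q₁.encode Q₂.encode f) ∧
      ∀ a, Q₁.IsYes a ↔ Q₂.IsYes (f a)

/-- Polynomial-time equivalence: reductions in both directions. -/
def DecisionProblem.PolyEquivalent (Q₁ Q₂ : DecisionProblem) : Prop :=
  Q₁.PolyReducible Q₂ ∧ Q₂.PolyReducible Q₁

/-! ### The graph isomorphism problem -/

/-- A finite simple graph on the vertex set `{0, …, order - 1}`. -/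
structure FinGraph where
  /-- the number of vertices -/
  order : ℕ
  /-- the graph -/
  graph : SimpleGraph (Fin order)

open scoped Classical in
/-- The encoding of a graph: the number of vertices in unary, closed by a `false`, followed by the
adjacency matrix, row by row. -/
noncomputable def FinGraph.encode (G : FinGraph) : List Bool :=
  List.replicate G.order true ++ false ::
    (List.finRange G.order).flatMap fun i =>
      (List.finRange G.order).map fun j => decide (G.graph.Adj i j)

/-- The graph isomorphism problem for a class of graphs: given two graphs of the class, are they
isomorphic? -/
noncomputable def graphIsoProblem (C : FinGraph → Prop) : DecisionProblem where
  Inst := {G : FinGraph // C G} × {G : FinGraph // C G}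
  encode p := p.1.1.encode ++ p.2.1.encode
  IsYes p := Nonempty (p.1.1.graph ≃g p.2.1.graph)

/-- The graph isomorphism problem for the class `C` is GI-complete: it is polynomial-time
equivalent to the problem for general graphs. -/
def GIComplete (C : FinGraph → Prop) : Prop :=
  (graphIsoProblem C).PolyEquivalent (graphIsoProblem fun _ => True)

/-! ### Posets, interval dimension, height, comparability graphs -/

/-- An interval order: every element has a closed real interval `[l x, r x]` so that `x ≺ y` exactly
if the interval of `x` lies entirely to the left of the interval of `y`. -/
def IsIntervalOrder {X : Type*} (P : PartialOrder X) : Prop :=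
  ∃ l r : X → ℝ, (∀ x, l x ≤ r x) ∧ ∀ x y, P.lt x y ↔ r x < l y

/-- The posets `F i` on a common ground set realize the poset `P`. -/
def Realizes {X ι : Type*} (F : ι → PartialOrder X) (P : PartialOrder X) : Prop :=
  ∀ x y, P.le x y ↔ ∀ i, (F i).le x y

/-- The interval dimension of a finite poset: the least number of interval orders realizing it. -/
noncomputable def intervalDimension {X : Type*} (P : PartialOrder X) : ℕ :=
  sInf {k : ℕ | ∃ F : Fin k → PartialOrder X, (∀ i, IsIntervalOrder (F i)) ∧ Realizes F P}

/-- The height of a finite poset: the largest number of elements of a chain. -/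
noncomputable def posetHeight {X : Type*} (P : PartialOrder X) : ℕ :=
  sSup {k : ℕ | ∃ Y : Finset X, IsChain P.le (Y : Set X) ∧ Y.card = k}

/-- The graph on the elements of a poset whose edges join the comparable pairs. -/
def comparabilityGraph {X : Type*} (P : PartialOrder X) : SimpleGraph X where
  Adj x y := P.lt x y ∨ P.lt y x
  symm := ⟨fun _ _ h => h.symm⟩
  loopless := ⟨fun x h => h.elim (@lt_irrefl X P.toPreorder x) (@lt_irrefl X P.toPreorder x)⟩

/-- `G` is a comparability graph of some finite poset of interval dimension `d` and height `h`. -/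
def IsComparabilityGraphOfDimHeight (d h : ℕ) (G : FinGraph) : Prop :=
  ∃ (X : Type) (_ : Finite X) (P : PartialOrder X),
    intervalDimension P = d ∧ posetHeight P = h ∧ Nonempty (G.graph ≃g comparabilityGraph P)

/-!
The restricted problem reduces to the general one by the identity. For the converse, a graph on `n`
vertices is turned into a poset of interval dimension `2` and height `3` whose comparability graph
determines the graph up to isomorphism, and the translation is carried out by a stack machine in
polynomial time.

*The gadget.* Let `A` be a symmetric matrix of bits over an index set `U`. Every index `i` has a
bottom element `b i` and a top element `t i`, and all bottom elements are below all top elements. A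
middle element in the cell `(i, j)` is above `b i` only and below `t j` only. The cell contains two
middle elements if `i = j` and `A i i = false`, one if `i = j` and `A i i = true` or if `i ≠ j` and
`A i j = true`, and none otherwise. In the plane, with `x ≺ y` if the box of `x` lies strictly to
the lower left of that of `y`, the bottom elements end on an antidiagonal and the top elements
start on a second one further up, so that a box reaching from just above a point of the first to
just below a point of the second realizes any middle element (`gadget_corner_iff`). This gives
interval dimension at most `2`; two indices `i ≠ j` yield `b i ≺ m`, `b j ≺ m'` without cross
relations, which excludes interval orders (`intervalDimension_gadgetOrder`). In the comparability
graph the bottom and top elements are the vertices with at least three neighbours, and the number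
of common neighbours of other kinds shows which bottom and top elements belong to the same index
and what `A` is (`exists_of_gadgetGraph_iso`). The matrix of a graph is its adjacency matrix with
two additional indices whose entries are all `true`; the vertices are recovered as the indices with
diagonal entry `false`. To make the numbering of the vertices uniform, every cell has room for one
element of each kind, and places that are not in use become isolated vertices.

*The machine.* Programs of a small language with counters, bit strings and loops (`StackProg`) have
a semantics that counts steps (`StackProg.Exec`) and are translated into machines with finitely
many stacks (`StackProg.polyTime_of_exec`). The program of the reduction writes the adjacency
matrix of the gadget graph by four nested loops over the row cell `(i, j)` and the column cell `(k,
l)`: an entry is a function of the kinds of the two vertices, the entries of the matrix at the two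
cells, and the equalities `i = j`, `k = l`, `i = k`, `j = l` (`kindAdj`).
-/

/-! ### Posets given by boxes -/

/-- The poset of a family of boxes: `x ≺ y` if in each coordinate `i` the interval `[l i x, r i x]`
of `x` lies to the left of the interval of `y`. -/
@[reducible]
def boxOrder {X ι : Type*} [Nonempty ι] (l r : ι → X → ℝ) (h : ∀ i x, l i x ≤ r i x) :
    PartialOrder X where
  le x y := x = y ∨ ∀ i, r i x < l i y
  le_refl x := Or.inl rfl
  le_trans x y z hxy hyz := by
    rcases hxy with rfl | hxy
    · exact hyz
    rcases hyz with rfl | hyz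
    · exact Or.inr hxy
    · exact Or.inr fun i => (hxy i).trans ((h i y).trans_lt (hyz i))
  le_antisymm x y hxy hyx := by
    rcases hxy with rfl | hxy
    · rfl
    rcases hyx with rfl | hyx
    · rfl
    · obtain ⟨i⟩ := ‹Nonempty ι›
      exact absurd ((hxy i).trans_le ((h i y).trans (hyx i).le)) (h i x).not_gt

theorem boxOrder_lt_iff {X ι : Type*} [Nonempty ι] {l r : ι → X → ℝ}
    (h : ∀ i x, l i x ≤ r i x) (x y : X) :
    (boxOrder l r h).lt x y ↔ ∀ i, r i x < l i y := by
  rw [(boxOrder l r h).lt_iff_le_not_ge]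
  obtain ⟨i₀⟩ := ‹Nonempty ι›
  constructor
  · rintro ⟨rfl | hxy, hyx⟩
    · exact absurd (Or.inl rfl) hyx
    · exact hxy
  · refine fun hxy => ⟨Or.inr hxy, ?_⟩
    rintro (rfl | hyx)
    · exact absurd (hxy i₀) (h i₀ y).not_gt
    · exact absurd ((hxy i₀).trans_le ((h i₀ y).trans (hyx i₀).le)) (h i₀ x).not_gt

theorem isIntervalOrder_boxOrder {X : Type*} (l r : Unit → X → ℝ) (h : ∀ i x, l i x ≤ r i x) :
    IsIntervalOrder (boxOrder l r h) :=
  ⟨l (), r (), h (), fun x y =>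
    (boxOrder_lt_iff h x y).trans ⟨fun h => h (), fun h _ => h⟩⟩

theorem realizes_boxOrder {X ι : Type*} [Nonempty ι] (l r : ι → X → ℝ)
    (h : ∀ i x, l i x ≤ r i x) :
    Realizes (fun i => boxOrder (fun _ : Unit => l i) (fun _ => r i) fun _ => h i)
      (boxOrder l r h) := by
  intro x y
  by_cases hxy : x = y
  · exact ⟨fun _ _ => Or.inl hxy, fun _ => Or.inl hxy⟩
  · refine (or_iff_right hxy).trans (forall_congr' fun i => ?_)
    exact ((or_iff_right hxy).trans (forall_const Unit)).symm

/-- Two chains `a ≺ b` and `c ≺ d` with `a ⊀ d` and `c ⊀ b`, which no interval order contains, force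
the interval dimension to be at least `2`. -/
theorem two_le_of_realizes {X : Type*} {P : PartialOrder X} {a b c d : X} (hab : P.lt a b)
    (hcd : P.lt c d) (had : ¬ P.lt a d) (hcb : ¬ P.lt c b) {k : ℕ} {F : Fin k → PartialOrder X}
    (hF : ∀ i, IsIntervalOrder (F i)) (hP : Realizes F P) : 2 ≤ k := by
  match k, F, hF, hP with
  | 0, F, _, hP => exact absurd ((hP b a).2 finZeroElim) (P.lt_iff_le_not_ge a b |>.1 hab).2
  | 1, F, hF, hP =>
    have hlt : ∀ x y, P.lt x y ↔ (F 0).lt x y := fun x y => by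
      rw [P.lt_iff_le_not_ge, (F 0).lt_iff_le_not_ge]
      exact and_congr ((hP x y).trans Fin.forall_fin_one)
        (not_congr ((hP y x).trans Fin.forall_fin_one))
    obtain ⟨l, r, -, h⟩ := hF 0
    simp only [hlt, h, not_lt] at hab hcd had hcb
    linarith
  | k + 2, _, _, _ => omega

theorem intervalDimension_boxOrder {X : Type*} {l r : Fin 2 → X → ℝ} (h : ∀ i x, l i x ≤ r i x)
    {a b c d : X} (hab : (boxOrder l r h).lt a b) (hcd : (boxOrder l r h).lt c d)
    (had : ¬ (boxOrder l r h).lt a d) (hcb : ¬ (boxOrder l r h).lt c b) :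
    intervalDimension (boxOrder l r h) = 2 := by
  have hmem : 2 ∈ {k : ℕ | ∃ F : Fin k → PartialOrder X,
      (∀ i, IsIntervalOrder (F i)) ∧ Realizes F (boxOrder l r h)} :=
    ⟨_, fun i => isIntervalOrder_boxOrder _ _ _, realizes_boxOrder l r h⟩
  refine le_antisymm (Nat.sInf_le hmem) (le_csInf ⟨2, hmem⟩ ?_)
  rintro k ⟨F, hF, hP⟩
  exact two_le_of_realizes hab hcd had hcb hF hP

/-- A strictly monotone rank with values in `{0, …, n - 1}` and a chain of `n` elements determine
the height. -/
theorem posetHeight_eq {X : Type*} (P : PartialOrder X) (n : ℕ) (rank : X → ℕ)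
    (hrank : ∀ x y, P.lt x y → rank x < rank y) (hn : ∀ x, rank x < n) (Y : Finset X)
    (hY : IsChain P.le (Y : Set X)) (hcard : Y.card = n) : posetHeight P = n := by
  have hle : ∀ k ∈ {k : ℕ | ∃ Y : Finset X, IsChain P.le (Y : Set X) ∧ Y.card = k}, k ≤ n := by
    rintro k ⟨Z, hZ, rfl⟩
    rw [← Finset.card_range n]
    refine Finset.card_le_card_of_injOn rank (fun x _ => by simpa using hn x) ?_
    intro x hx y hy hxy
    by_contra hne
    have key : ∀ x y, P.le x y → x ≠ y → P.lt x y := fun x y hle hne =>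
      (P.lt_iff_le_not_ge x y).2 ⟨hle, fun h => hne (P.le_antisymm x y hle h)⟩
    rcases hZ hx hy hne with h | h
    · exact (hrank _ _ (key _ _ h hne)).ne hxy
    · exact (hrank _ _ (key _ _ h (Ne.symm hne))).ne' hxy
  exact le_antisymm (csSup_le ⟨n, Y, hY, hcard⟩ hle) (le_csSup ⟨n, hle⟩ ⟨Y, hY, hcard⟩)

/-! ### The gadget graph -/

/-- Whether the vertex of kind `τ` in the cell `(i, j)` is in use, where `d` says that `i = j` and
`a` is the entry of the matrix at `(i, j)`. The kinds `0` and `1` are the bottom and the top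
elements, one of each for every index; the kinds `2` and `3` are two layers of middle elements. Two
middle elements mark a diagonal cell with entry `false`, one marks any other diagonal cell and any
off-diagonal cell with entry `true`. Vertices that are not in use are isolated. -/
def kindActive (τ : Fin 4) (d a : Bool) : Bool :=
  match τ with
  | 0 => d
  | 1 => d
  | 2 => d || a
  | 3 => d && !a

/-- Whether kind `τ` lies below kind `τ'`, where `r` and `c` say that the two cells lie in the same
row and in the same column: a middle element is above the bottom element of its row and below the
top element of its column, and bottom elements are below all top elements. -/
def kindBelow (τ τ' : Fin 4) (r c : Bool) : Bool :=
  match τ, τ' with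
  | 0, 1 => true
  | 0, 2 => r
  | 0, 3 => r
  | 2, 1 => c
  | 3, 1 => c
  | _, _ => false

/-- The entry of the adjacency matrix of the gadget graph: kinds `τ` and `τ'`, diagonal bits `d`
and `d'` and matrix entries `a` and `a'` of the two cells; `r` and `c` compare their rows and their
columns. -/
def kindAdj (τ τ' : Fin 4) (d d' a a' r c : Bool) : Bool :=
  kindActive τ d a && kindActive τ' d' a' && (kindBelow τ τ' r c || kindBelow τ' τ r c)

section Gadget

variable {U : Type*} [DecidableEq U] (A : U → U → Bool)

/-- The strict order on the vertices of the gadget graph; `(i, j, τ)` is the vertex of kind `τ` in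
the cell `(i, j)`. -/
def GadgetBelow (x y : U × U × Fin 4) : Prop :=
  kindActive x.2.2 (x.1 = x.2.1) (A x.1 x.2.1) = true ∧
  kindActive y.2.2 (y.1 = y.2.1) (A y.1 y.2.1) = true ∧
  kindBelow x.2.2 y.2.2 (x.1 = y.1) (x.2.1 = y.2.1) = true

/-- The adjacency matrix of the gadget graph. -/
def gadgetAdj (x y : U × U × Fin 4) : Bool :=
  kindAdj x.2.2 y.2.2 (x.1 = x.2.1) (y.1 = y.2.1) (A x.1 x.2.1) (A y.1 y.2.1)
    (x.1 = y.1) (x.2.1 = y.2.1)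

theorem gadgetAdj_iff (x y : U × U × Fin 4) :
    gadgetAdj A x y = true ↔ GadgetBelow A x y ∨ GadgetBelow A y x := by
  simp only [gadgetAdj, kindAdj, GadgetBelow, Bool.and_eq_true, Bool.or_eq_true,
    show (decide (y.1 = x.1)) = decide (x.1 = y.1) from decide_eq_decide.2 eq_comm,
    show (decide (y.2.1 = x.2.1)) = decide (x.2.1 = y.2.1) from decide_eq_decide.2 eq_comm]
  tauto

/-- The gadget graph of a matrix `A`. -/
def gadgetGraph : SimpleGraph (U × U × Fin 4) where
  Adj x y := gadgetAdj A x y = true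
  symm := ⟨fun x y h => (gadgetAdj_iff A y x).2 ((gadgetAdj_iff A x y).1 h).symm⟩
  loopless := ⟨by
    rintro ⟨i, j, τ⟩ h
    have : ∀ τ : Fin 4, ∀ d a, kindAdj τ τ d d a a true true = false := by decide
    simp [gadgetAdj, this] at h⟩

/-- A box for every vertex of the gadget graph, given by the position `p i < m` of every index `i`.
The upper corners of the bottom elements lie on the antidiagonal of the square `[1, 2m + 1]²`, the
lower corners of the top elements on the antidiagonal of a translated square; a middle element
reaches from just above the former to just below the latter. A vertex that is not in use overlaps
with everything. This is the lower corner of the box of the vertex of kind `τ` in the cell `(i,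
j)`, in the coordinate `κ`, where `act` says that the vertex is in use. -/
def gadgetLower (m : ℕ) (act : Bool) (i j : ℕ) (τ : Fin 4) (κ : Fin 2) : ℕ :=
  if act then
    match τ with
    | 0 => 0
    | 1 => 2 * m + 5 + 2 * (if κ = 0 then j else m - j)
    | _ => 2 + 2 * (if κ = 0 then i else m - i)
  else 0

/-- The upper corners of the boxes of `gadgetLower`. -/
def gadgetUpper (m : ℕ) (act : Bool) (i j : ℕ) (τ : Fin 4) (κ : Fin 2) : ℕ :=
  if act then
    match τ with
    | 0 => 1 + 2 * (if κ = 0 then i else m - i)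
    | 1 => 4 * m + 5
    | _ => 2 * m + 4 + 2 * (if κ = 0 then j else m - j)
  else 4 * m + 5

theorem gadgetLower_le_gadgetUpper {m : ℕ} (act : Bool) {i j : ℕ} (hi : i < m) (hj : j < m)
    (τ : Fin 4) (κ : Fin 2) : gadgetLower m act i j τ κ ≤ gadgetUpper m act i j τ κ := by
  unfold gadgetLower gadgetUpper
  cases act <;> fin_cases τ <;> fin_cases κ <;> simp <;> omega

/-- The order of the boxes is the order of the kinds. -/
theorem gadget_corner_iff {m : ℕ} (b b' : Bool) {i j k l : ℕ} (hi : i < m) (hj : j < m)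
    (hk : k < m) (hl : l < m) (τ τ' : Fin 4) :
    (∀ κ, gadgetUpper m b i j τ κ < gadgetLower m b' k l τ' κ) ↔
      b = true ∧ b' = true ∧ kindBelow τ τ' (i = k) (j = l) = true := by
  rw [Fin.forall_fin_two]
  unfold gadgetLower gadgetUpper
  cases b <;> cases b' <;> fin_cases τ <;> fin_cases τ' <;> simp [kindBelow] <;> omega


/-- The poset of the gadget boxes, for positions given by `p`. -/
noncomputable abbrev gadgetOrder {m : ℕ} (p : U → Fin m) : PartialOrder (U × U × Fin 4) :=
  boxOrder
    (fun κ x => (gadgetLower m (kindActive x.2.2 (x.1 = x.2.1) (A x.1 x.2.1))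
      (p x.1) (p x.2.1) x.2.2 κ : ℝ))
    (fun κ x => (gadgetUpper m (kindActive x.2.2 (x.1 = x.2.1) (A x.1 x.2.1))
      (p x.1) (p x.2.1) x.2.2 κ : ℝ))
    (fun κ x => Nat.cast_le.2
      (gadgetLower_le_gadgetUpper _ (p x.1).isLt (p x.2.1).isLt x.2.2 κ))

theorem gadgetOrder_lt_iff {m : ℕ} {p : U → Fin m} (hp : Function.Injective p)
    (x y : U × U × Fin 4) : (gadgetOrder A p).lt x y ↔ GadgetBelow A x y := by
  rw [boxOrder_lt_iff]
  simp only [Nat.cast_lt]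
  rw [gadget_corner_iff _ _ (p x.1).isLt (p x.2.1).isLt (p y.1).isLt (p y.2.1).isLt]
  simp only [Fin.val_inj, hp.eq_iff]
  rfl

theorem comparabilityGraph_gadgetOrder {m : ℕ} {p : U → Fin m} (hp : Function.Injective p) :
    comparabilityGraph (gadgetOrder A p) = gadgetGraph A := by
  ext x y
  exact (or_congr (gadgetOrder_lt_iff A hp x y) (gadgetOrder_lt_iff A hp y x)).trans
    (gadgetAdj_iff A x y).symm

theorem intervalDimension_gadgetOrder {m : ℕ} {p : U → Fin m} (hp : Function.Injective p)
    [Nontrivial U] : intervalDimension (gadgetOrder A p) = 2 := by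
  obtain ⟨u, v, huv⟩ := exists_pair_ne U
  refine intervalDimension_boxOrder _ (a := (u, u, 0)) (b := (u, u, 2)) (c := (v, v, 0))
    (d := (v, v, 2)) ?_ ?_ ?_ ?_ <;> rw [gadgetOrder_lt_iff A hp] <;>
    simp [GadgetBelow, kindActive, kindBelow, huv, huv.symm]

theorem posetHeight_gadgetOrder {m : ℕ} {p : U → Fin m} (hp : Function.Injective p)
    [Nonempty U] : posetHeight (gadgetOrder A p) = 3 := by
  obtain ⟨u⟩ := ‹Nonempty U›
  have hle : ∀ x y, GadgetBelow A x y → (gadgetOrder A p).le x y := fun x y h =>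
    ((gadgetOrder A p).lt_iff_le_not_ge x y |>.1 ((gadgetOrder_lt_iff A hp x y).2 h)).1
  have h1 : GadgetBelow A (u, u, 0) (u, u, 2) := by simp [GadgetBelow, kindActive, kindBelow]
  have h2 : GadgetBelow A (u, u, 2) (u, u, 1) := by simp [GadgetBelow, kindActive, kindBelow]
  have h3 : GadgetBelow A (u, u, 0) (u, u, 1) := by simp [GadgetBelow, kindActive, kindBelow]
  refine posetHeight_eq _ 3 (fun x => match x.2.2 with | 0 => 0 | 1 => 2 | _ => 1) ?_ ?_
    {(u, u, 0), (u, u, 2), (u, u, 1)} ?_ ?_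
  · rintro ⟨i, j, τ⟩ ⟨k, l, τ'⟩ h
    have hb := ((gadgetOrder_lt_iff A hp _ _).1 h).2.2
    fin_cases τ <;> fin_cases τ' <;> simp_all [kindBelow]
  · rintro ⟨i, j, τ⟩
    fin_cases τ <;> simp
  · intro x hx y hy hxy
    simp only [Finset.coe_insert, Finset.coe_singleton, Set.mem_insert_iff,
      Set.mem_singleton_iff] at hx hy
    rcases hx with rfl | rfl | rfl <;> rcases hy with rfl | rfl | rfl <;>
      first
        | exact absurd rfl hxy
        | exact Or.inl (hle _ _ ‹_›)
        | exact Or.inr (hle _ _ ‹_›)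
  · simp

variable {A}

/-- The gadget graph depends on the matrix only up to simultaneous permutations of its rows and
columns. -/
def gadgetGraphIso {V : Type*} [DecidableEq V] {B : V → V → Bool} (e : U ≃ V)
    (he : ∀ u v, B (e u) (e v) = A u v) : gadgetGraph A ≃g gadgetGraph B where
  toEquiv := e.prodCongr (e.prodCongr (Equiv.refl _))
  map_rel_iff' := by
    rintro ⟨i, j, τ⟩ ⟨k, l, τ'⟩
    simp [gadgetGraph, gadgetAdj, he]

/-! ### Recovering the matrix from the gadget graph -/

/-- The vertices with at least three neighbours. -/
def HasThreeNbrs {X : Type*} (G : SimpleGraph X) (x : X) : Prop :=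
  ∃ p q r, p ≠ q ∧ p ≠ r ∧ q ≠ r ∧ G.Adj x p ∧ G.Adj x q ∧ G.Adj x r

/-- `w` is a common neighbour of `x` and `y` with at most two neighbours. -/
def IsLink {X : Type*} (G : SimpleGraph X) (x y w : X) : Prop :=
  G.Adj x w ∧ G.Adj y w ∧ ¬ HasThreeNbrs G w

theorem hasThreeNbrs_iff_of_iso {X Y : Type*} {G : SimpleGraph X} {H : SimpleGraph Y}
    (φ : G ≃g H) (x : X) : HasThreeNbrs H (φ x) ↔ HasThreeNbrs G x := by
  simp only [HasThreeNbrs, φ.surjective.exists, φ.map_adj_iff, φ.injective.ne_iff]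

theorem isLink_iff_of_iso {X Y : Type*} {G : SimpleGraph X} {H : SimpleGraph Y}
    (φ : G ≃g H) (x y w : X) : IsLink H (φ x) (φ y) (φ w) ↔ IsLink G x y w := by
  simp only [IsLink, φ.map_adj_iff, hasThreeNbrs_iff_of_iso]

/-- The vertices with three neighbours are the bottom and top elements in use: for at least two
indices, each of them is adjacent to two elements of the opposite kind and to the middle element of
its cell, whereas a middle element has at most two neighbours. -/
theorem hasThreeNbrs_gadgetGraph_iff [Nontrivial U] (x : U × U × Fin 4) :
    HasThreeNbrs (gadgetGraph A) x ↔ x.1 = x.2.1 ∧ (x.2.2 = 0 ∨ x.2.2 = 1) := by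
  obtain ⟨i, j, τ⟩ := x
  constructor
  · rintro ⟨p, q, r, hpq, hpr, hqr, hp, hq, hr⟩
    have key : ∀ w, (gadgetGraph A).Adj (i, j, τ) w →
        (i = j ∧ (τ = 0 ∨ τ = 1)) ∨ w = (i, i, 0) ∨ w = (j, j, 1) := by
      rintro ⟨k, l, τ'⟩ h
      rcases (gadgetAdj_iff A _ _).1 h with h | h <;>
        fin_cases τ <;> fin_cases τ' <;>
          simp_all [GadgetBelow, kindActive, kindBelow] <;>
          grind
    rcases key p hp with h | rfl | rfl
    · exact h
    all_goals
      rcases key q hq with h | rfl | rfl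
      · exact h
      all_goals
        rcases key r hr with h | rfl | rfl
        · exact h
        all_goals simp at hpq hpr hqr
  · rintro ⟨rfl : i = j, hτ⟩
    obtain ⟨k, hk⟩ := exists_ne i
    rcases hτ with rfl | rfl
    · refine ⟨(i, i, 1), (k, k, 1), (i, i, 2), ?_, ?_, ?_, ?_, ?_, ?_⟩ <;>
        simp [gadgetGraph, gadgetAdj, kindAdj, kindActive, kindBelow, hk.symm]
    · refine ⟨(i, i, 0), (k, k, 0), (i, i, 2), ?_, ?_, ?_, ?_, ?_, ?_⟩ <;>
        simp [gadgetGraph, gadgetAdj, kindAdj, kindActive, kindBelow, hk.symm]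

theorem isLink_comm {X : Type*} {G : SimpleGraph X} {x y w : X} :
    IsLink G x y w ↔ IsLink G y x w := by
  unfold IsLink
  tauto

theorem isLink_gadgetGraph_iff [Nontrivial U] (i j : U) (w : U × U × Fin 4) :
    IsLink (gadgetGraph A) (i, i, 0) (j, j, 1) w ↔
      w = (i, j, 2) ∧ (i = j ∨ A i j = true) ∨ w = (i, j, 3) ∧ i = j ∧ A i j = false := by
  obtain ⟨k, l, τ⟩ := w
  rw [IsLink, hasThreeNbrs_gadgetGraph_iff]
  fin_cases τ <;>
    simp [gadgetGraph, gadgetAdj, kindAdj, kindActive, kindBelow] <;> grind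

/-- The bottom and the top element of an index are joined by two links, those of different indices
by one link or none, depending on the entry of the matrix. The symmetry of the matrix makes the
statement independent of which of the two vertices is the bottom element. -/
theorem exists_isLink_iff [Nontrivial U] (hA : ∀ i j, A i j = A j i) {x y : U × U × Fin 4}
    (hx : HasThreeNbrs (gadgetGraph A) x) (hy : HasThreeNbrs (gadgetGraph A) y)
    (hxy : (gadgetGraph A).Adj x y) :
    ((∃ w, IsLink (gadgetGraph A) x y w) ↔ x.1 = y.1 ∨ A x.1 y.1 = true) ∧
    ((∃ w w', w ≠ w' ∧ IsLink (gadgetGraph A) x y w ∧ IsLink (gadgetGraph A) x y w') ↔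
      x.1 = y.1 ∧ A x.1 x.1 = false) := by
  have key : ∀ i j : U,
      ((∃ w, IsLink (gadgetGraph A) (i, i, 0) (j, j, 1) w) ↔ i = j ∨ A i j = true) ∧
      ((∃ w w', w ≠ w' ∧ IsLink (gadgetGraph A) (i, i, 0) (j, j, 1) w ∧
        IsLink (gadgetGraph A) (i, i, 0) (j, j, 1) w') ↔ i = j ∧ A i i = false) := by
    intro i j
    simp only [isLink_gadgetGraph_iff]
    constructor
    · constructor
      · rintro ⟨w, ⟨-, h⟩ | ⟨-, h, -⟩⟩
        exacts [h, Or.inl h]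
      · exact fun h => ⟨_, Or.inl ⟨rfl, h⟩⟩
    · constructor
      · rintro ⟨w, w', hne, ⟨rfl, -⟩ | ⟨-, hij, h⟩, ⟨rfl, -⟩ | ⟨rfl, hij', h'⟩⟩
        · exact absurd rfl hne
        · exact ⟨hij', by rwa [← hij'] at h'⟩
        · exact ⟨hij, by rwa [← hij] at h⟩
        · exact ⟨hij', by rwa [← hij'] at h'⟩
      · rintro ⟨rfl, h⟩
        exact ⟨(i, i, 2), (i, i, 3), by simp, Or.inl ⟨rfl, Or.inl rfl⟩, Or.inr ⟨rfl, rfl, h⟩⟩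
  rw [hasThreeNbrs_gadgetGraph_iff] at hx hy
  obtain ⟨i, i', τ⟩ := x
  obtain ⟨j, j', τ'⟩ := y
  obtain ⟨rfl : i = i', hτ⟩ := hx
  obtain ⟨rfl : j = j', hτ'⟩ := hy
  rcases hτ with rfl | rfl <;> rcases hτ' with rfl | rfl
  · simp [gadgetGraph, gadgetAdj, kindAdj, kindBelow] at hxy
  · exact key i j
  · have hswap : ∀ w, IsLink (gadgetGraph A) (i, i, 1) (j, j, 0) w =
        IsLink (gadgetGraph A) (j, j, 0) (i, i, 1) w := fun w => propext isLink_comm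
    simp only [hswap]
    refine ⟨(key j i).1.trans ?_, (key j i).2.trans ?_⟩
    · rw [hA j i, eq_comm]
    · constructor <;> (rintro ⟨rfl, h⟩; exact ⟨rfl, h⟩)
  · simp [gadgetGraph, gadgetAdj, kindAdj, kindBelow] at hxy

/-- An isomorphism of gadget graphs induces an embedding of the indices with diagonal entry
`false` that preserves the matrix. -/
theorem exists_of_gadgetGraph_iso {V : Type*} [DecidableEq V] {B : V → V → Bool} [Nontrivial U]
    [Nontrivial V] (hA : ∀ i j, A i j = A j i) (hB : ∀ i j, B i j = B j i)
    (φ : gadgetGraph A ≃g gadgetGraph B) :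
    ∃ σ : U → V, (∀ i, A i i = false → B (σ i) (σ i) = false) ∧
      ∀ i j, A i i = false → A j j = false → (σ i = σ j → i = j) ∧ A i j = B (σ i) (σ j) := by
  have hbot : ∀ i : U, HasThreeNbrs (gadgetGraph A) (i, i, 0) := fun i =>
    (hasThreeNbrs_gadgetGraph_iff _).2 ⟨rfl, Or.inl rfl⟩
  have htop : ∀ i : U, HasThreeNbrs (gadgetGraph A) (i, i, 1) := fun i =>
    (hasThreeNbrs_gadgetGraph_iff _).2 ⟨rfl, Or.inr rfl⟩
  have hadj : ∀ i j : U, (gadgetGraph A).Adj (i, i, 0) (j, j, 1) := fun i j => by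
    simp [gadgetGraph, gadgetAdj, kindAdj, kindActive, kindBelow]
  have hsrc := fun i j => exists_isLink_iff hA (hbot i) (htop j) (hadj i j)
  have htgt := fun i j => exists_isLink_iff hB ((hasThreeNbrs_iff_of_iso φ _).2 (hbot i))
    ((hasThreeNbrs_iff_of_iso φ _).2 (htop j)) (φ.map_adj_iff.2 (hadj i j))
  simp only [φ.surjective.exists, isLink_iff_of_iso, φ.injective.ne_iff] at htgt
  have hone := fun i j => (hsrc i j).1.symm.trans (htgt i j).1
  have htwo := fun i j => (hsrc i j).2.symm.trans (htgt i j).2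
  simp only at hone htwo
  have hσ : ∀ i, A i i = false → (φ (i, i, 0)).1 = (φ (i, i, 1)).1 := fun i hi =>
    ((htwo i i).1 ⟨rfl, hi⟩).1
  have hdiag : ∀ i, A i i = false → B (φ (i, i, 0)).1 (φ (i, i, 0)).1 = false := fun i hi =>
    ((htwo i i).1 ⟨rfl, hi⟩).2
  -- An index with entry `false` has two links between its bottom and its top element, so `φ` maps
  -- the two to the bottom and top elements, in some order, of a common index.
  refine ⟨fun i => (φ (i, i, 0)).1, hdiag, fun i j hi hj => ?_⟩
  have hinj : (φ (i, i, 0)).1 = (φ (j, j, 0)).1 → i = j := fun h =>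
    ((htwo i j).2 ⟨h.trans (hσ j hj), hdiag i hi⟩).1
  refine ⟨hinj, ?_⟩
  by_cases hij : i = j
  · subst hij
    rw [hi, hdiag i hi]
  · have := hone i j
    rw [← hσ j hj, or_iff_right hij, or_iff_right fun h => hij (hinj h)] at this
    exact Bool.eq_iff_iff.2 this

end Gadget

/-! ### A programming language for stack machines -/

/-- Programs over counters `C`, which hold natural numbers, and strings `D`, which hold words of
bits. Besides these there is a register of type `R` and one more register for the symbol read last,
which is `none` after an attempt to read from an empty store. -/
inductive StackProg (C D R : Type) where
  /-- increment a counter -/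
  | inc (c : C)
  /-- decrement a counter and record whether it was positive -/
  | dec (c : C)
  /-- push a bit that depends on the registers -/
  | push (d : D) (g : R → Option Bool → Bool)
  /-- pop a bit -/
  | pop (d : D)
  /-- change the register -/
  | load (f : R → Option Bool → R)
  /-- sequential composition -/
  | seq (p q : StackProg C D R)
  /-- branch on the symbol read last -/
  | ite (t : Option Bool → Bool) (p q : StackProg C D R)
  /-- as long as the counter is positive, decrement it and run the body -/
  | loop (c : C) (p : StackProg C D R)
  /-- as long as the string is not empty, pop a bit and run the body -/
  | drain (d : D) (p : StackProg C D R)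

/-- The states on which programs operate. -/
@[ext]
structure ProgState (C D R : Type) where
  /-- the register -/
  reg : R
  /-- the symbol read last -/
  cur : Option Bool
  /-- the values of the counters -/
  cnt : C → ℕ
  /-- the contents of the strings -/
  str : D → List Bool

namespace StackProg

variable {C D R : Type} [DecidableEq C] [DecidableEq D]

/-- `Exec p s s' b`: started in the state `s`, the program `p` ends in the state `s'` after at most
`b` steps of a stack machine. -/
inductive Exec : StackProg C D R → ProgState C D R → ProgState C D R → ℕ → Prop
  | inc (c s) : Exec (inc c) s { s with cnt := Function.update s.cnt c (s.cnt c + 1) } 1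
  | dec (c s) : Exec (dec c) s
      { s with cur := if s.cnt c = 0 then none else some true,
               cnt := Function.update s.cnt c (s.cnt c - 1) } 1
  | push (d g s) : Exec (push d g) s
      { s with str := Function.update s.str d (g s.reg s.cur :: s.str d) } 1
  | pop (d s) : Exec (pop d) s
      { s with cur := (s.str d).head?, str := Function.update s.str d (s.str d).tail } 1
  | load (f s) : Exec (load f) s { s with reg := f s.reg s.cur } 1
  | seq {p q s₁ s₂ s₃ b₁ b₂} : Exec p s₁ s₂ b₁ → Exec q s₂ s₃ b₂ → Exec (seq p q) s₁ s₃ (b₁ + b₂)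
  | ite_true {t p q s₁ s₂ b} : t s₁.cur = true → Exec p s₁ s₂ b → Exec (ite t p q) s₁ s₂ (b + 1)
  | ite_false {t p q s₁ s₂ b} : t s₁.cur = false → Exec q s₁ s₂ b → Exec (ite t p q) s₁ s₂ (b + 1)
  | loop_zero {c p s} : s.cnt c = 0 → Exec (loop c p) s { s with cur := none } 1
  | loop_succ {c p s₁ s₂ s₃ n b₁ b₂} : s₁.cnt c = n + 1 →
      Exec p { s₁ with cur := some true, cnt := Function.update s₁.cnt c n } s₂ b₁ →
      Exec (loop c p) s₂ s₃ b₂ → Exec (loop c p) s₁ s₃ (b₁ + b₂ + 1)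
  | drain_nil {d p s} : s.str d = [] → Exec (drain d p) s { s with cur := none } 1
  | drain_cons {d p s₁ s₂ s₃ x l b₁ b₂} : s₁.str d = x :: l →
      Exec p { s₁ with cur := some x, str := Function.update s₁.str d l } s₂ b₁ →
      Exec (drain d p) s₂ s₃ b₂ → Exec (drain d p) s₁ s₃ (b₁ + b₂ + 1)
  | mono {p s₁ s₂ b b'} : Exec p s₁ s₂ b → b ≤ b' → Exec p s₁ s₂ b'

theorem Exec.conv {p : StackProg C D R} {s s' s'' : ProgState C D R} {b b' : ℕ}
    (h : Exec p s s' b) (hs : s' = s'') (hb : b ≤ b') : Exec p s s'' b' :=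
  hs ▸ h.mono hb

/-! ### Translation into stack machines -/

/-- The labels of the machine code of a program. -/
def Label : StackProg C D R → Type
  | seq p q => Label p ⊕ Label q
  | ite _ p q => Option (Label p ⊕ Label q)
  | loop _ p => Option (Label p)
  | drain _ p => Option (Label p)
  | _ => Unit

omit [DecidableEq C] [DecidableEq D] in
theorem finite_label (p : StackProg C D R) : Finite (Label p) := by
  induction p with
  | seq p q hp hq => exact inferInstanceAs (Finite (Label p ⊕ Label q))
  | ite t p q hp hq => exact inferInstanceAs (Finite (Option (Label p ⊕ Label q)))
  | loop c p hp => exact inferInstanceAs (Finite (Option (Label p)))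
  | drain c p hp => exact inferInstanceAs (Finite (Option (Label p)))
  | _ => exact inferInstanceAs (Finite Unit)

/-- The label at which the machine code of a program starts. -/
def entry : (p : StackProg C D R) → Label p
  | seq p _ => Sum.inl (entry p)
  | ite _ _ _ => (none : Option _)
  | loop _ _ => (none : Option _)
  | drain _ _ => (none : Option _)
  | inc _ => ()
  | dec _ => ()
  | push _ _ => ()
  | pop _ => ()
  | load _ => ()

open Turing.TM2 in
/-- The machine code of a program inside a machine with labels `L`: the labels of the program are
embedded by `e`, and control passes to `x` at the end. A counter is a stack of bits `true`. -/
def compile {L : Type} : (p : StackProg C D R) → (Label p → L) → L → Label p →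
    Stmt (fun _ : C ⊕ D => Bool) L (R × Option Bool)
  | inc c, _, x, _ => .push (.inl c) (fun _ => true) (.goto fun _ => x)
  | dec c, _, x, _ => .pop (.inl c) (fun v o => (v.1, o)) (.goto fun _ => x)
  | push d g, _, x, _ => .push (.inr d) (fun v => g v.1 v.2) (.goto fun _ => x)
  | pop d, _, x, _ => .pop (.inr d) (fun v o => (v.1, o)) (.goto fun _ => x)
  | load f, _, x, _ => .load (fun v => (f v.1 v.2, v.2)) (.goto fun _ => x)
  | seq p q, e, _, .inl l => compile p (fun l => e (.inl l)) (e (.inr (entry q))) l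
  | seq _ q, e, x, .inr l => compile q (fun l => e (.inr l)) x l
  | ite t p q, e, _, none => .branch (fun v => t v.2)
      (.goto fun _ => e (some (.inl (entry p)))) (.goto fun _ => e (some (.inr (entry q))))
  | ite _ p _, e, x, some (.inl l) => compile p (fun l => e (some (.inl l))) x l
  | ite _ _ q, e, x, some (.inr l) => compile q (fun l => e (some (.inr l))) x l
  | loop c p, e, x, none => .pop (.inl c) (fun v o => (v.1, o)) (.branch (fun v => v.2.isSome)
      (.goto fun _ => e (some (entry p))) (.goto fun _ => x))
  | loop _ p, e, _, some l => compile p (fun l => e (some l)) (e none) l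
  | drain d p, e, x, none => .pop (.inr d) (fun v o => (v.1, o)) (.branch (fun v => v.2.isSome)
      (.goto fun _ => e (some (entry p))) (.goto fun _ => x))
  | drain _ p, e, _, some l => compile p (fun l => e (some l)) (e none) l

/-- The stacks of a machine that represent a state. -/
def memory (s : ProgState C D R) : C ⊕ D → List Bool
  | .inl c => List.replicate (s.cnt c) true
  | .inr d => s.str d

/-- The configuration of a machine that represents a state. -/
def config {L : Type} (l : L) (s : ProgState C D R) :
    Turing.TM2.Cfg (fun _ : C ⊕ D => Bool) L (R × Option Bool) :=
  ⟨some l, (s.reg, s.cur), memory s⟩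

/-- The machine reaches `c'` from `c` in at most `b` steps. -/
def ReachesIn {X : Type*} (f : X → Option X) (c c' : X) (b : ℕ) : Prop :=
  ∃ n ≤ b, (flip bind f)^[n] (some c) = some c'

omit [DecidableEq C] [DecidableEq D] in
theorem ReachesIn.trans {X : Type*} {f : X → Option X} {c₁ c₂ c₃ : X} {b₁ b₂ : ℕ}
    (h₁ : ReachesIn f c₁ c₂ b₁) (h₂ : ReachesIn f c₂ c₃ b₂) : ReachesIn f c₁ c₃ (b₁ + b₂) := by
  obtain ⟨n₁, hn₁, e₁⟩ := h₁
  obtain ⟨n₂, hn₂, e₂⟩ := h₂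
  exact ⟨n₂ + n₁, by omega, by rw [Function.iterate_add_apply, e₁, e₂]⟩

omit [DecidableEq C] [DecidableEq D] in
theorem ReachesIn.mono {X : Type*} {f : X → Option X} {c c' : X} {b b' : ℕ}
    (h : ReachesIn f c c' b) (hb : b ≤ b') : ReachesIn f c c' b' := by
  obtain ⟨n, hn, e⟩ := h
  exact ⟨n, hn.trans hb, e⟩

omit [DecidableEq C] [DecidableEq D] in
theorem ReachesIn.single {X : Type*} {f : X → Option X} {c c' : X} (h : f c = some c') :
    ReachesIn f c c' 1 :=
  ⟨1, le_rfl, by simpa [flip] using h⟩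

theorem memory_cnt (s : ProgState C D R) (r : R) (o : Option Bool) (c : C) (n : ℕ) :
    memory ⟨r, o, Function.update s.cnt c n, s.str⟩ =
      Function.update (memory s) (.inl c) (List.replicate n true) := by
  funext k
  rcases k with k | k
  · by_cases h : k = c
    · subst h; simp [memory]
    · simp [memory, h]
  · simp [memory]

theorem memory_str (s : ProgState C D R) (r : R) (o : Option Bool) (d : D) (l : List Bool) :
    memory ⟨r, o, s.cnt, Function.update s.str d l⟩ =
      Function.update (memory s) (.inr d) l := by
  funext k
  rcases k with k | k
  · simp [memory]
  · by_cases h : k = d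
    · subst h; simp [memory]
    · simp [memory, h]

/-- Machine code simulates the program. -/
theorem Exec.reachesIn {p : StackProg C D R} {s s' : ProgState C D R} {b : ℕ}
    (h : Exec p s s' b) {L : Type}
    (M : L → Turing.TM2.Stmt (fun _ : C ⊕ D => Bool) L (R × Option Bool))
    (e : Label p → L) (x : L) (hM : ∀ l, M (e l) = compile p e x l) :
    ReachesIn (Turing.TM2.step M) (config (e (entry p)) s) (config x s') b := by
  induction h generalizing x with
  | inc c s =>
    apply ReachesIn.single
    simp only [config, Turing.TM2.step, hM]
    simp [compile, memory_cnt, memory, List.replicate_succ]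
  | dec c s =>
    apply ReachesIn.single
    simp only [config, Turing.TM2.step, hM]
    simp [compile, memory_cnt, memory, List.head?_replicate, List.tail_replicate]
  | push d g s =>
    apply ReachesIn.single
    simp only [config, Turing.TM2.step, hM]
    simp [compile, memory_str, memory]
  | pop d s =>
    apply ReachesIn.single
    simp only [config, Turing.TM2.step, hM]
    simp [compile, memory_str, memory]
  | load f s =>
    apply ReachesIn.single
    simp only [config, Turing.TM2.step, hM]
    simp [compile]
    rfl
  | seq _ _ ih₁ ih₂ =>
    exact (ih₁ _ _ fun l => hM (.inl l)).trans (ih₂ _ _ fun l => hM (.inr l))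
  | @ite_true t p q s₁ s₂ b ht _ ih =>
    refine (ReachesIn.trans (ReachesIn.single ?_)
      (ih (fun l => e (some (.inl l))) x fun l => hM (some (.inl l)))).mono (by omega)
    have h0 : M (e none) = compile (ite t p q) e x none := hM none
    simp [config, entry, h0, compile, ht]
  | @ite_false t p q s₁ s₂ b ht _ ih =>
    refine (ReachesIn.trans (ReachesIn.single ?_)
      (ih (fun l => e (some (.inr l))) x fun l => hM (some (.inr l)))).mono (by omega)
    have h0 : M (e none) = compile (ite t p q) e x none := hM none
    simp [config, entry, h0, compile, ht]
  | @loop_zero c p s h =>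
    apply ReachesIn.single
    have h0 : M (e none) = compile (loop c p) e x none := hM none
    have hm : memory s (.inl c) = [] := by simp [memory, h]
    simp only [config, entry, Turing.TM2.step, h0, compile, Turing.TM2.stepAux, hm]
    rw [show ([] : List Bool).tail = memory s (.inl c) from hm.symm, Function.update_eq_self]
    rfl
  | @loop_succ c p s₁ s₂ s₃ n b₁ b₂ h _ _ ih₁ ih₂ =>
    refine (ReachesIn.trans (ReachesIn.single ?_)
      ((ih₁ (fun l => e (some l)) (e none) fun l => hM (some l)).trans
        (ih₂ e x hM))).mono (by omega)
    have h0 : M (e none) = compile (loop c p) e x none := hM none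
    have hm : memory s₁ (.inl c) = true :: List.replicate n true := by
      simp [memory, h, List.replicate_succ]
    simp [config, entry, h0, compile, memory_cnt, hm]
  | @drain_nil d p s h =>
    apply ReachesIn.single
    have h0 : M (e none) = compile (drain d p) e x none := hM none
    have hm : memory s (.inr d) = [] := h
    simp only [config, entry, Turing.TM2.step, h0, compile, Turing.TM2.stepAux, hm]
    rw [show ([] : List Bool).tail = memory s (.inr d) from hm.symm, Function.update_eq_self]
    rfl
  | @drain_cons d p s₁ s₂ s₃ x' l b₁ b₂ h _ _ ih₁ ih₂ =>
    refine (ReachesIn.trans (ReachesIn.single ?_)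
      ((ih₁ (fun l => e (some l)) (e none) fun l => hM (some l)).trans
        (ih₂ e x hM))).mono (by omega)
    have h0 : M (e none) = compile (drain d p) e x none := hM none
    have hm : memory s₁ (.inr d) = x' :: l := h
    simp [config, entry, h0, compile, memory_str, hm]
  | mono _ hb ih => exact (ih e x hM).mono hb

/-- The machine that runs a program and then halts; `dIn` and `dOut` are its input and its output.
-/
noncomputable def toFinTM2 [Fintype C] [Fintype D] [Fintype R] (p : StackProg C D R)
    (dIn dOut : D) (r₀ : R) : Turing.FinTM2 where
  K := C ⊕ D
  k₀ := .inr dIn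
  k₁ := .inr dOut
  Γ := fun _ => Bool
  Λ := Option (Label p)
  main := some (entry p)
  ΛFin := by
    haveI := finite_label p
    exact Fintype.ofFinite _
  σ := R × Option Bool
  initialState := (r₀, none)
  Γk₀Fin := inferInstanceAs (Fintype Bool)
  m l := match l with
    | none => .halt
    | some l => compile p some none l

section Correctness

variable [Fintype C] [Fintype D] [Fintype R]

omit [DecidableEq C] [Fintype C] [Fintype D] [Fintype R] in
theorem memory_zero_update (r : R) (d d' : D) (w : List Bool) :
    memory ⟨r, none, fun _ : C => 0, Function.update (fun _ => []) d w⟩ (.inr d') =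
      if d' = d then w else [] := by
  by_cases h : d' = d
  · subst h; simp [memory]
  · simp [memory, h]

theorem initList_toFinTM2 (p : StackProg C D R) (dIn dOut : D) (r₀ : R) (w : List Bool) :
    Turing.initList (toFinTM2 p dIn dOut r₀) w =
      config (some (entry p)) ⟨r₀, none, fun _ => 0, Function.update (fun _ => []) dIn w⟩ := by
  refine congrArg (Turing.TM2.Cfg.mk _ _) (funext fun k => ?_)
  rcases k with c | d
  · exact dif_neg (by simp [toFinTM2])
  · rw [memory_zero_update]
    by_cases h : d = dIn
    · subst h
      rw [if_pos rfl]
      exact dif_pos rfl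
    · rw [if_neg h]
      exact dif_neg (by simpa [toFinTM2] using h)

theorem haltList_toFinTM2 (p : StackProg C D R) (dIn dOut : D) (r₀ : R) (w : List Bool) :
    Turing.haltList (toFinTM2 p dIn dOut r₀) w =
      ⟨none, (r₀, none), memory ⟨r₀, none, fun _ : C => 0,
        Function.update (fun _ => []) dOut w⟩⟩ := by
  refine congrArg (Turing.TM2.Cfg.mk _ _) (funext fun k => ?_)
  rcases k with c | d
  · exact dif_neg (by simp [toFinTM2])
  · rw [memory_zero_update]
    by_cases h : d = dOut
    · subst h
      rw [if_pos rfl]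
      exact dif_pos rfl
    · rw [if_neg h]
      exact dif_neg (by simpa [toFinTM2] using h)

/-- A program whose execution turns the code of `a` into the code of `f a` within a number of steps
that is polynomial in the length of the input makes `f` computable in polynomial time. Apart from
its input and its output all stores are empty at both ends. -/
theorem polyTime_of_exec {α β : Type} {ea : α → List Bool}
    {eb : β → List Bool} {f : α → β} (p : StackProg C D R) (dIn dOut : D) (r₀ : R)
    (P : Polynomial ℕ)
    (h : ∀ a, Exec p ⟨r₀, none, fun _ => 0, Function.update (fun _ => []) dIn (ea a)⟩
      ⟨r₀, none, fun _ => 0, Function.update (fun _ => []) dOut (eb (f a))⟩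
      (P.eval (ea a).length)) :
    Nonempty (Turing.TM2ComputableInPolyTime ea eb f) := by
  have key : ∀ a, ReachesIn (toFinTM2 p dIn dOut r₀).step
      (Turing.initList (toFinTM2 p dIn dOut r₀) (ea a))
      (Turing.haltList (toFinTM2 p dIn dOut r₀) (eb (f a))) ((P + 1).eval (ea a).length) := by
    intro a
    rw [initList_toFinTM2, haltList_toFinTM2]
    refine (((h a).reachesIn (toFinTM2 p dIn dOut r₀).m some none fun l => rfl).trans
      (ReachesIn.single ?_)).mono (by simp)
    rfl
  choose n hn e using key
  exact ⟨{
    tm := toFinTM2 p dIn dOut r₀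
    inputAlphabet := Equiv.refl Bool
    outputAlphabet := Equiv.refl Bool
    time := P + 1
    outputsFun := fun a =>
      { steps := n a
        evals_in_steps := by
          exact (congrArg (fun w => (flip bind (toFinTM2 p dIn dOut r₀).step)^[n a]
              (some (Turing.initList (toFinTM2 p dIn dOut r₀) w))) (List.map_id (ea a))).trans
            ((e a).trans (congrArg (fun w => some (Turing.haltList (toFinTM2 p dIn dOut r₀) w))
              (List.map_id (eb (f a))).symm))
        steps_le_m := hn a } }⟩

end Correctness

end StackProg

/-! ### The program -/

namespace Reduction

/-- The counters of the program. Each of the four loop variables `x` is a pair of counters: `done x`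
is its value and `todo x` is the number of rounds that are left. -/
inductive Counter where
  | done (x : Fin 4)
  | todo (x : Fin 4)
  | auxA
  | auxB
  deriving DecidableEq, Fintype

/-- The strings of the program. -/
inductive Word where
  | inp
  | out
  | work
  | bits
  | rows
  | cols
  | seen
  deriving DecidableEq

instance : Fintype Word :=
  ⟨{.inp, .out, .work, .bits, .rows, .cols, .seen}, fun d => by cases d <;> simp⟩

/-- The registers of the program: the kind and the matrix entry of the current row of the output,
the matrix entry of the current column, and the results of four comparisons. -/
structure Regs where
  kind : Fin 4
  rowBit : Bool
  colBit : Bool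
  same : Fin 4 → Bool
  deriving Fintype

/-- The contents of the strings. -/
@[ext]
structure Tapes where
  inp : List Bool
  out : List Bool
  work : List Bool
  bits : List Bool
  rows : List Bool
  cols : List Bool
  seen : List Bool

/-- The strings as a function. -/
def Tapes.str (T : Tapes) : Word → List Bool
  | .inp => T.inp
  | .out => T.out
  | .work => T.work
  | .bits => T.bits
  | .rows => T.rows
  | .cols => T.cols
  | .seen => T.seen

section update
variable (T : Tapes) (l : List Bool)

@[simp] theorem update_inp : Function.update T.str .inp l = { T with inp := l }.str := by
  funext d; cases d <;> rfl
@[simp] theorem update_out : Function.update T.str .out l = { T with out := l }.str := by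
  funext d; cases d <;> rfl
@[simp] theorem update_work : Function.update T.str .work l = { T with work := l }.str := by
  funext d; cases d <;> rfl
@[simp] theorem update_bits : Function.update T.str .bits l = { T with bits := l }.str := by
  funext d; cases d <;> rfl
@[simp] theorem update_rows : Function.update T.str .rows l = { T with rows := l }.str := by
  funext d; cases d <;> rfl
@[simp] theorem update_cols : Function.update T.str .cols l = { T with cols := l }.str := by
  funext d; cases d <;> rfl
@[simp] theorem update_seen : Function.update T.str .seen l = { T with seen := l }.str := by
  funext d; cases d <;> rfl

end update

open StackProg

/-- Programs with the stores of the reduction. -/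
abbrev Prog := StackProg Counter Word Regs

/-- `Runs p r c T r' c' T' b`: whatever symbol has been read last, `p` takes the registers, counters
and strings `r c T` to `r' c' T'` within `b` steps. -/
def Runs (p : Prog) (r : Regs) (c : Counter → ℕ) (T : Tapes) (r' : Regs) (c' : Counter → ℕ)
    (T' : Tapes) (b : ℕ) : Prop :=
  ∀ o, ∃ o', Exec p ⟨r, o, c, T.str⟩ ⟨r', o', c', T'.str⟩ b

theorem Runs.seq {p q : Prog} {r₁ r₂ r₃ : Regs} {c₁ c₂ c₃ : Counter → ℕ} {T₁ T₂ T₃ : Tapes}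
    {b₁ b₂ : ℕ} (hp : Runs p r₁ c₁ T₁ r₂ c₂ T₂ b₁) (hq : Runs q r₂ c₂ T₂ r₃ c₃ T₃ b₂) :
    Runs (p.seq q) r₁ c₁ T₁ r₃ c₃ T₃ (b₁ + b₂) := fun o => by
  obtain ⟨o₁, h₁⟩ := hp o
  obtain ⟨o₂, h₂⟩ := hq o₁
  exact ⟨o₂, h₁.seq h₂⟩

theorem Runs.mono {p : Prog} {r r' : Regs} {c c' : Counter → ℕ} {T T' : Tapes} {b b' : ℕ}
    (h : Runs p r c T r' c' T' b) (hb : b ≤ b') : Runs p r c T r' c' T' b' := fun o => by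
  obtain ⟨o', h'⟩ := h o
  exact ⟨o', h'.mono hb⟩

theorem Runs.conv {p : Prog} {r r' r'' : Regs} {c c' c'' : Counter → ℕ} {T T' T'' : Tapes}
    {b b' : ℕ} (h : Runs p r c T r' c' T' b) (hr : r' = r'') (hc : c' = c'') (hT : T' = T'')
    (hb : b ≤ b') : Runs p r c T r'' c'' T'' b' := by
  subst hr hc hT
  exact h.mono hb

theorem Runs.congr {p : Prog} {r r' : Regs} {c c' : Counter → ℕ} {T T' S S' : Tapes} {b b' : ℕ}
    (h : Runs p r c T r' c' T' b) (hT : T = S) (hT' : T' = S') (hb : b ≤ b') :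
    Runs p r c S r' c' S' b' := by
  subst hT hT'
  exact h.mono hb

theorem runs_load (f : Regs → Regs) (r c T) : Runs (.load fun r _ => f r) r c T (f r) c T 1 :=
  fun o => ⟨o, Exec.load _ _⟩

theorem runs_inc (k : Counter) (r c T) :
    Runs (.inc k) r c T r (Function.update c k (c k + 1)) T 1 :=
  fun o => ⟨o, Exec.inc _ _⟩

theorem runs_push_work (g : Regs → Bool) (r c T) :
    Runs (.push .work fun r _ => g r) r c T r c { T with work := g r :: T.work } 1 :=
  fun o => ⟨o, (Exec.push _ _ _).conv (by simp [Tapes.str]) le_rfl⟩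

theorem runs_push_bits (x : Bool) (r c T) :
    Runs (.push .bits fun _ _ => x) r c T r c { T with bits := x :: T.bits } 1 :=
  fun o => ⟨o, (Exec.push _ _ _).conv (by simp [Tapes.str]) le_rfl⟩

/-! ### Comparing counters -/

/-- Compare the counters `x` and `y` and store the result in the flag `f`. The first loop empties
`x` and takes as much from `y`, keeping copies in the auxiliary counters; the counters are equal if
`y` did not run out before and is empty then. The last two loops restore `x` and `y`. -/
def eqTest (x y : Counter) (f : Fin 4) : Prog :=
  .seq (.load fun r _ => { r with same := Function.update r.same f true }) <|
  .seq (.loop x (.seq (.inc .auxA) (.seq (.dec y) (.ite Option.isSome (.inc .auxB)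
    (.load fun r _ => { r with same := Function.update r.same f false }))))) <|
  .seq (.seq (.dec y) (.ite Option.isSome
    (.seq (.inc y) (.load fun r _ => { r with same := Function.update r.same f false }))
    (.load fun r _ => r))) <|
  .seq (.loop .auxA (.inc x)) (.loop .auxB (.inc y))

/-- Adding `x` to `y`. The final counters `c'` are described by their values, so that the induction
does not accumulate updates. -/
theorem exec_loop_move (x y : Counter) (hxy : x ≠ y) (n : ℕ) (r : Regs) (o : Option Bool)
    (c c' : Counter → ℕ) (str : Word → List Bool) (hn : c x = n) (hx : c' x = 0)
    (hy : c' y = c y + n) (hc : ∀ k, k ≠ x → k ≠ y → c' k = c k) :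
    Exec (.loop x (.inc y) : Prog) ⟨r, o, c, str⟩ ⟨r, none, c', str⟩ (2 * n + 1) := by
  induction n generalizing o c with
  | zero =>
    refine (Exec.loop_zero hn).conv ?_ le_rfl
    have : c = c' := by
      funext k
      by_cases hkx : k = x
      · rw [hkx, hn, hx]
      · by_cases hky : k = y
        · rw [hky, hy, Nat.add_zero]
        · exact (hc k hkx hky).symm
    simp [this]
  | succ n ih =>
    refine (Exec.loop_succ hn (Exec.inc _ _) (ih _ _ ?_ ?_ ?_)).mono (by omega)
    · simp [hxy]
    · simp [hxy.symm, hy]; omega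
    · intro k hkx hky
      simp [hkx, hky, hc]

/-- The first loop of `eqTest`: `auxA` keeps `x`, `auxB` keeps the part taken from `y`, and the flag
drops if `y` is too small. -/
theorem exec_eqTest_loop (x y : Counter) (f : Fin 4) (hxy : x ≠ y) (hx : x ≠ .auxA)
    (hx' : x ≠ .auxB) (hy : y ≠ .auxA) (hy' : y ≠ .auxB) (n : ℕ) (r r' : Regs) (o : Option Bool)
    (c c' : Counter → ℕ) (str : Word → List Bool) (hn : c x = n)
    (hr : r' = { r with same := Function.update r.same f (r.same f && decide (n ≤ c y)) })
    (h1 : c' x = 0) (h2 : c' y = c y - n) (h3 : c' .auxA = c .auxA + n)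
    (h4 : c' .auxB = c .auxB + min n (c y))
    (hc : ∀ k, k ≠ x → k ≠ y → k ≠ .auxA → k ≠ .auxB → c' k = c k) :
    Exec (.loop x (.seq (.inc .auxA) (.seq (.dec y) (.ite Option.isSome (.inc .auxB)
      (.load fun r _ => { r with same := Function.update r.same f false })))) : Prog)
      ⟨r, o, c, str⟩ ⟨r', none, c', str⟩ (5 * n + 1) := by
  induction n generalizing o c r with
  | zero =>
    refine (Exec.loop_zero hn).conv ?_ le_rfl
    have : c = c' := by
      funext k
      by_cases k1 : k = x
      · rw [k1, hn, h1]
      by_cases k2 : k = y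
      · rw [k2, h2, Nat.sub_zero]
      by_cases k3 : k = .auxA
      · rw [k3, h3, Nat.add_zero]
      by_cases k4 : k = .auxB
      · rw [k4, h4, Nat.zero_min, Nat.add_zero]
      exact (hc k k1 k2 k3 k4).symm
    simp [hr, this]
  | succ n ih =>
    by_cases h0 : c y = 0
    · refine (Exec.loop_succ hn (Exec.seq (Exec.inc _ _) (Exec.seq (Exec.dec _ _)
        (Exec.ite_false ?_ (Exec.load _ _)))) (ih _ _ _ ?_ ?_ ?_ ?_ ?_ ?_)).mono
          (le_of_eq (by ring))
      · simp [hxy.symm, hy, h0]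
      · simp [hx, hxy]
      · simp [hr, h0]
      · simp [hxy.symm, hy, h0, h2]
      · simp [hx.symm, hy.symm, h3]; omega
      · simp [hx'.symm, hy'.symm, hy, hxy.symm, h4, h0]
      · intro k k1 k2 k3 k4
        simp [k1, k2, k3, hc k k1 k2 k3 k4]
    · refine (Exec.loop_succ hn (Exec.seq (Exec.inc _ _) (Exec.seq (Exec.dec _ _)
        (Exec.ite_true ?_ (Exec.inc _ _)))) (ih _ _ _ ?_ ?_ ?_ ?_ ?_ ?_)).mono
          (le_of_eq (by ring))
      · simp [hxy.symm, hy, h0]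
      · simp [hx, hxy, hx']
      · simp [hr, hxy.symm, hy, hy']; grind
      · simp [hxy.symm, hy, hy', h2]; omega
      · simp [hx.symm, hy.symm, h3]; omega
      · simp [hx'.symm, hy'.symm, hy, hy', hxy.symm, h4]; omega
      · intro k k1 k2 k3 k4
        simp [k1, k2, k3, k4, hc k k1 k2 k3 k4]

theorem runs_eqTest (x y : Counter) (f : Fin 4) (hxy : x ≠ y) (hx : x ≠ .auxA)
    (hx' : x ≠ .auxB) (hy : y ≠ .auxA) (hy' : y ≠ .auxB) (r : Regs) (c : Counter → ℕ)
    (hA : c .auxA = 0) (hB : c .auxB = 0) (T : Tapes) :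
    Runs (eqTest x y f) r c T
      { r with same := Function.update r.same f (decide (c x = c y)) } c T
      (10 * c x + 10) := by
  intro o
  refine ⟨none, ?_⟩
  let r₁ : Regs := { r with same := Function.update r.same f (decide (c x ≤ c y)) }
  let r₂ : Regs := { r with same := Function.update r.same f (decide (c x = c y)) }
  let c₁ : Counter → ℕ := Function.update (Function.update (Function.update (Function.update c x 0)
    y (c y - c x)) .auxA (c x)) .auxB (min (c x) (c y))
  let c₂ : Counter → ℕ := Function.update c₁ .auxA 0
  let c₃ : Counter → ℕ := Function.update c₂ x (c x)
  have e1 := exec_eqTest_loop x y f hxy hx hx' hy hy' (c x)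
    { r with same := Function.update r.same f true } r₁ o c c₁ T.str rfl (by simp [r₁])
    (by simp [c₁, hx, hx', hxy]) (by simp [c₁, hy, hy']) (by simp [c₁, hA])
    (by simp [c₁, hB]) (fun k k1 k2 k3 k4 => by simp [c₁, k1, k2, k3, k4])
  have e2 : ∃ o', Exec (.seq (.dec y) (.ite Option.isSome
      (.seq (.inc y) (.load fun r _ => { r with same := Function.update r.same f false }))
      (.load fun r _ => r)) : Prog) ⟨r₁, none, c₁, T.str⟩ ⟨r₂, o', c₁, T.str⟩ 4 := by
    have hc₁y : c₁ y = c y - c x := by simp [c₁, hy, hy']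
    by_cases h0 : c₁ y = 0
    · refine ⟨none, ((Exec.dec _ _).seq (Exec.ite_false ?_ (Exec.load _ _))).conv ?_ (by omega)⟩
      · simp [h0]
      · have : (c x ≤ c y) ↔ c x = c y := by omega
        have h0' : Function.update c₁ y 0 = c₁ := by rw [← h0, Function.update_eq_self]
        simp [h0, r₁, r₂, this, h0']
    · refine ⟨some true, ((Exec.dec _ _).seq (Exec.ite_true ?_
        ((Exec.inc _ _).seq (Exec.load _ _)))).conv ?_ (by omega)⟩
      · simp [h0]
      · have : c x ≠ c y := by omega
        simp only [r₁, r₂, this]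
        have : c₁ y - 1 + 1 = c₁ y := by omega
        simp [h0, this]
  obtain ⟨o', e2⟩ := e2
  have e3 := exec_loop_move .auxA x hx.symm (c x) r₂ o' c₁ c₃ T.str
    (by simp [c₁]) (by simp [c₃, c₂, hx.symm]) (by simp [c₃, c₁, hx, hx', hxy])
    (fun k k1 k2 => by simp [c₃, c₂, k1, k2])
  have e4 := exec_loop_move .auxB y hy'.symm (min (c x) (c y)) r₂ none c₃ c T.str
    (by simp [c₃, c₂, c₁, hx'.symm]) hB (by simp [c₃, c₂, c₁, hxy.symm, hy, hy']; omega)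
    (fun k k1 k2 => by
      by_cases k3 : k = x
      · subst k3; simp [c₃]
      · by_cases k4 : k = .auxA
        · subst k4; simp [c₃, c₂, hx.symm, hA]
        · simp [c₃, c₂, c₁, k1, k2, k3, k4])
  exact ((Exec.load _ _).seq (e1.seq (e2.seq (e3.seq e4)))).mono (by omega)


/-! ### Loops over the indices -/

/-- The values of the counters when the loop variables, ranging over `{0, …, m}`, have the
values `v`. -/
def counters (m : ℕ) (v : Fin 4 → ℕ) : Counter → ℕ
  | .done x => v x
  | .todo x => m - v x
  | .auxA => 0
  | .auxB => 0

/-- Run `p` once for each of the values `1, …, m` of the loop variable `x`, then reset `x`. -/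
def forLoop (x : Fin 4) (p : Prog) : Prog :=
  .seq (.loop (.todo x) (.seq (.inc (.done x)) p)) (.loop (.done x) (.inc (.todo x)))

/-- The running time of a loop of `m` rounds, each of which takes time `b`. -/
def loopTime {S : Type*} [CommSemiring S] (m b : S) : S := m * (b + 4) + 2

theorem runs_forLoop {x : Fin 4} {p : Prog} {m b : ℕ} {r : Regs} {v : Fin 4 → ℕ} (hv : v x = 0)
    (T : ℕ → Tapes) (h : ∀ t < m, Runs p r (counters m (Function.update v x (t + 1))) (T t)
      r (counters m (Function.update v x (t + 1))) (T (t + 1)) b) :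
    Runs (forLoop x p) r (counters m v) (T 0) r (counters m v) (T m) (loopTime m b) := by
  have hrounds : ∀ k t, t + k = m → ∀ o,
      Exec (.loop (.todo x) (.seq (.inc (.done x)) p))
        ⟨r, o, counters m (Function.update v x t), (T t).str⟩
        ⟨r, none, counters m (Function.update v x m), (T m).str⟩ (k * (b + 2) + 1) := by
    intro k
    induction k with
    | zero =>
      intro t ht o
      obtain rfl : t = m := ht
      exact (Exec.loop_zero (by simp [counters])).conv rfl (by omega)
    | succ k ih =>
      intro t ht o
      obtain ⟨o', h'⟩ := h t (by omega) (some true)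
      refine (Exec.loop_succ (n := k) (by simp [counters]; omega)
        ((Exec.inc _ _).seq ?_) (ih (t + 1) (by omega) o')).mono
          (b := 1 + b + (k * (b + 2) + 1) + 1)
        (by ring_nf; omega)
      convert h' using 2
      funext c
      rcases c with y | y | _ | _
      · by_cases hy : y = x
        · subst hy; simp [counters]
        · simp [counters, hy]
      · by_cases hy : y = x
        · subst hy; simp [counters]; omega
        · simp [counters, hy]
      · simp [counters]
      · simp [counters]
  intro o
  refine ⟨none, Exec.mono ((Exec.conv (s' := ⟨r, none, counters m (Function.update v x m),
    (T m).str⟩) (b' := m * (b + 2) + 1) ?_ rfl le_rfl).seq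
    (exec_loop_move (.done x) (.todo x) (by simp) m r none _ (counters m v) (T m).str ?_ ?_ ?_ ?_))
    (by unfold loopTime; ring_nf; omega)⟩
  · have := hrounds m 0 (by omega) o
    rwa [show Function.update v x 0 = v from
      Function.update_eq_self_iff.2 hv.symm] at this
  · simp [counters]
  · simp [counters, hv]
  · simp [counters, hv]
  · intro k hk hk'
    rcases k with y | y | _ | _
    · have hy : y ≠ x := fun h => hk (by rw [h])
      simp [counters, hy]
    · have hy : y ≠ x := fun h => hk' (by rw [h])
      simp [counters, hy]
    · rfl
    · rfl

/-! ### Writing the adjacency matrix -/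

/-- The registers between two entries of the output, in a row of kind `τ` whose cell has the matrix
entry `a`. -/
def rowRegs (τ : Fin 4) (a : Bool) : Regs := ⟨τ, a, false, fun _ => false⟩

/-- The entry of the output that the registers determine in a column of kind `τ`. -/
def Regs.entry (r : Regs) (τ : Fin 4) : Bool :=
  kindAdj r.kind τ (r.same 0) (r.same 1) r.rowBit r.colBit (r.same 2) (r.same 3)

/-- Write the four entries of the output in the column cell `(k, l)` of the row of kind `τ` in the
cell `(i, j)`, for the loop variables `i`, `j`, `k`, `l`. -/
def writeCell : Prog :=
  .seq (.seq (.pop .cols) (.seq (.push .seen fun _ o => o == some true)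
    (.load fun r o => { r with colBit := o == some true }))) <|
  .seq (eqTest (.done 0) (.done 1) 0) <| .seq (eqTest (.done 2) (.done 3) 1) <|
  .seq (eqTest (.done 0) (.done 2) 2) <| .seq (eqTest (.done 1) (.done 3) 3) <|
  .seq (.push .work fun r _ => r.entry 0) <| .seq (.push .work fun r _ => r.entry 1) <|
  .seq (.push .work fun r _ => r.entry 2) <| .seq (.push .work fun r _ => r.entry 3) <|
  .load fun r _ => rowRegs r.kind r.rowBit

theorem runs_writeCell {m : ℕ} {v : Fin 4 → ℕ} (hv : ∀ x, v x ≤ m) (τ : Fin 4) (a x : Bool)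
    (l : List Bool) (T : Tapes) (hT : T.cols = x :: l) :
    Runs writeCell (rowRegs τ a) (counters m v) T (rowRegs τ a) (counters m v)
      { T with
        cols := l
        seen := x :: T.seen
        work := ((List.finRange 4).map fun τ' => kindAdj τ τ' (v 0 = v 1) (v 2 = v 3) a x
          (v 0 = v 2) (v 1 = v 3)).reverse ++ T.work } (40 * m + 48) := by
  have h1 : Runs (.seq (.pop .cols) (.seq (.push .seen fun _ o => o == some true)
      (.load fun r o => { r with colBit := o == some true }))) (rowRegs τ a) (counters m v) T
      { rowRegs τ a with colBit := x } (counters m v)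
      { T with cols := l, seen := x :: T.seen } 3 := fun o =>
    ⟨some x, ((Exec.pop _ _).seq ((Exec.push _ _ _).seq (Exec.load _ _))).conv
      (by simp [Tapes.str, hT]) le_rfl⟩
  have h2 := fun (x y : Fin 4) (hxy : x ≠ y) (f r T) => (runs_eqTest (.done x) (.done y) f
    (by simpa using hxy) (by simp) (by simp) (by simp) (by simp) r (counters m v) rfl rfl T).mono
      (b' := 10 * m + 10) (by have := hv x; simp [counters]; omega)
  refine (h1.seq ((h2 0 1 (by decide) 0 _ _).seq ((h2 2 3 (by decide) 1 _ _).seq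
    ((h2 0 2 (by decide) 2 _ _).seq ((h2 1 3 (by decide) 3 _ _).seq ((runs_push_work _ _ _ _).seq
    ((runs_push_work _ _ _ _).seq ((runs_push_work _ _ _ _).seq ((runs_push_work _ _ _ _).seq
    (runs_load _ _ _ _)))))))))).conv rfl rfl ?_ (by omega)
  simp [Regs.entry, rowRegs, counters, List.finRange_succ]
  exact ⟨rfl, rfl, rfl, rfl⟩

section Output

variable (α : ℕ → ℕ → Bool) (m : ℕ)

/-- The entries of the matrix `α`, row by row. -/
def matrixBits : List Bool :=
  (List.range m).flatMap fun i => (List.range m).map (α i)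

/-- Write the four entries of the output in the columns of the cell `(k, l)`. -/
def cellBits (i j : ℕ) (τ : Fin 4) (k l : ℕ) : List Bool :=
  (List.finRange 4).map fun τ' =>
    kindAdj τ τ' (i = j) (k = l) (α i j) (α k l) (i = k) (j = l)

/-- The row of the output for the vertex of kind `τ` in the cell `(i, j)`. -/
def rowBits (i j : ℕ) (τ : Fin 4) : List Bool :=
  (List.range m).flatMap fun k => (List.range m).flatMap fun l => cellBits α i j τ k l

/-- The adjacency matrix of the gadget graph, row by row. -/
def gadgetBits : List Bool :=
  (List.range m).flatMap fun i => (List.range m).flatMap fun j =>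
    (List.finRange 4).flatMap fun τ => rowBits α m i j τ

/-- Write a row of the output and restore the copy of the matrix that is read on the way. -/
def writeRow : Prog :=
  .seq (forLoop 2 (forLoop 3 writeCell))
    (.drain .seen (.push .cols fun _ o => o == some true))

theorem runs_drain_seen (l : List Bool) (r : Regs) (c : Counter → ℕ) (T : Tapes)
    (hT : T.seen = l) :
    Runs (.drain .seen (.push .cols fun _ o => o == some true)) r c T r c
      { T with seen := [], cols := l.reverse ++ T.cols } (2 * l.length + 1) := by
  induction l generalizing T with
  | nil =>
    intro o
    refine ⟨none, (Exec.drain_nil (d := Word.seen) (s := ⟨r, o, c, T.str⟩) hT).conv ?_ (by simp)⟩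
    obtain ⟨inp, out, work, bits, rows, cols, seen⟩ := T
    obtain rfl : seen = [] := hT
    rfl
  | cons x l ih =>
    intro o
    obtain ⟨o', h⟩ := ih { T with seen := l, cols := x :: T.cols } rfl (some x)
    refine ⟨o', (Exec.drain_cons (d := Word.seen) (x := x) (l := l) (s₁ := ⟨r, o, c, T.str⟩) hT
      ((Exec.push _ _ _).conv (s'' := ⟨r, some x, c,
        { T with seen := l, cols := x :: T.cols }.str⟩) ?_ le_rfl) h).conv
      ?_ ?_⟩
    · simp [Tapes.str]
    · simp
    · simp; omega

theorem range'_succ_sub {t m : ℕ} (ht : t < m) :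
    List.range' t (m - t) = t :: List.range' (t + 1) (m - (t + 1)) := by
  rw [show m - t = (m - (t + 1)) + 1 by omega, List.range'_succ]

/-- The time to write a row of the output. -/
def rowTime {S : Type*} [CommSemiring S] (m : S) : S :=
  loopTime m (loopTime m (40 * m + 48)) + (2 * (m * m) + 1)

theorem length_matrixBits : (matrixBits α m).length = m * m := by
  simp [matrixBits, List.length_flatMap]

theorem runs_writeRow {v : Fin 4 → ℕ} {i j : ℕ} (hi : i < m) (hj : j < m) (h0 : v 0 = i + 1)
    (h1 : v 1 = j + 1) (h2 : v 2 = 0) (h3 : v 3 = 0) (τ : Fin 4) (T : Tapes)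
    (hcols : T.cols = matrixBits α m) (hseen : T.seen = []) :
    Runs writeRow (rowRegs τ (α i j)) (counters m v) T (rowRegs τ (α i j)) (counters m v)
      { T with work := (rowBits α m i j τ).reverse ++ T.work } (rowTime m) := by
  have hloop := runs_forLoop (p := forLoop 3 writeCell) (m := m) (x := 2)
    (b := loopTime m (40 * m + 48)) (r := rowRegs τ (α i j)) (v := v) h2
    (fun t => { T with
      cols := (List.range' t (m - t)).flatMap fun k => (List.range m).map (α k)
      seen := ((List.range t).flatMap fun k => (List.range m).map (α k)).reverse
      work := ((List.range t).flatMap fun k => (List.range m).flatMap fun l =>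
        cellBits α i j τ k l).reverse ++ T.work }) ?_
  · refine Runs.conv (Runs.seq (b₁ := loopTime m (loopTime m (40 * m + 48))) ?_
      (runs_drain_seen (matrixBits α m).reverse _ _
      { T with cols := [], seen := (matrixBits α m).reverse,
               work := (rowBits α m i j τ).reverse ++ T.work } rfl)) rfl rfl ?_ ?_
    rotate_left
    · ext1 <;> simp [hcols, hseen]
    rotate_left
    · convert hloop using 1
      · ext1 <;> simp [hcols, hseen, List.range_eq_range', matrixBits]
      · ext1 <;> simp [matrixBits, rowBits]
    · simp [rowTime, length_matrixBits]
  · intro k hk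
    have := runs_forLoop (p := writeCell) (m := m) (x := 3)
      (b := 40 * m + 48) (r := rowRegs τ (α i j)) (v := Function.update v 2 (k + 1)) (by simp [h3])
      (fun t => { T with
        cols := (List.range' t (m - t)).map (α k) ++
          (List.range' (k + 1) (m - (k + 1))).flatMap fun k => (List.range m).map (α k)
        seen := ((List.range t).map (α k)).reverse ++
          ((List.range k).flatMap fun k => (List.range m).map (α k)).reverse
        work := ((List.range t).flatMap fun l => cellBits α i j τ k l).reverse ++
          (((List.range k).flatMap fun k => (List.range m).flatMap fun l =>
            cellBits α i j τ k l).reverse ++ T.work) }) ?_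
    · convert this using 1
      · ext1 <;> simp [range'_succ_sub hk, List.range_eq_range']
      · ext1 <;> simp [List.range_succ]
    · intro l hl
      refine (runs_writeCell ?_ τ (α i j) (α k l) ((List.range' (l + 1) (m - (l + 1))).map (α k) ++
        (List.range' (k + 1) (m - (k + 1))).flatMap fun k => (List.range m).map (α k)) _ ?_).conv
        rfl rfl ?_ le_rfl
      · intro x
        fin_cases x <;> simp [h0, h1] <;> omega
      · simp [range'_succ_sub hl]
      · ext1 <;> simp [List.range_succ, cellBits, h0, h1]


/-- Write the four rows of the output for the next cell. -/
def writeRows : Prog :=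
  .seq (.seq (.pop .rows) (.load fun r o => { r with rowBit := o == some true })) <|
  .seq (.load fun r _ => { r with kind := 0 }) <| .seq writeRow <|
  .seq (.load fun r _ => { r with kind := 1 }) <| .seq writeRow <|
  .seq (.load fun r _ => { r with kind := 2 }) <| .seq writeRow <|
  .seq (.load fun r _ => { r with kind := 3 }) <| .seq writeRow <|
  .load fun _ _ => rowRegs 0 false

theorem runs_writeRows {v : Fin 4 → ℕ} {i j : ℕ} (hi : i < m) (hj : j < m) (h0 : v 0 = i + 1)
    (h1 : v 1 = j + 1) (h2 : v 2 = 0) (h3 : v 3 = 0) (T : Tapes) (l : List Bool)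
    (hrows : T.rows = α i j :: l) (hcols : T.cols = matrixBits α m) (hseen : T.seen = []) :
    Runs writeRows (rowRegs 0 false) (counters m v) T (rowRegs 0 false) (counters m v)
      { T with
        rows := l
        work := ((List.finRange 4).flatMap fun τ => rowBits α m i j τ).reverse ++ T.work }
      (4 * rowTime m + 7) := by
  have hread : Runs (.seq (.pop .rows) (.load fun r o => { r with rowBit := o == some true }))
      (rowRegs 0 false) (counters m v) T (rowRegs 0 (α i j)) (counters m v)
      { T with rows := l } 2 := fun o =>
    ⟨some (α i j), ((Exec.pop _ _).seq (Exec.load _ _)).conv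
      (by simp [Tapes.str, hrows, rowRegs]) le_rfl⟩
  have hkind := fun (τ τ' : Fin 4) T =>
    runs_load (fun r => { r with kind := τ' }) (rowRegs τ (α i j)) (counters m v) T
  have hrow := fun τ T => runs_writeRow α m hi hj h0 h1 h2 h3 τ T
  refine (hread.seq ((hkind 0 0 _).seq ((hrow 0 _ ?_ ?_).seq ((hkind 0 1 _).seq
    ((hrow 1 _ ?_ ?_).seq ((hkind 1 2 _).seq ((hrow 2 _ ?_ ?_).seq ((hkind 2 3 _).seq
    ((hrow 3 _ ?_ ?_).seq (runs_load (fun _ => rowRegs 0 false) _ _ _)))))))))).conv rfl rfl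
    ?_ (by omega)
  all_goals try assumption
  simp [List.finRange_succ]

/-- Write the adjacency matrix of the gadget graph. -/
def writeGadget : Prog := forLoop 0 (forLoop 1 writeRows)

/-- The time to write the adjacency matrix of the output. -/
def gadgetTime {S : Type*} [CommSemiring S] (m : S) : S :=
  loopTime m (loopTime m (4 * rowTime m + 7))

theorem runs_writeGadget (T : Tapes) (hrows : T.rows = matrixBits α m)
    (hcols : T.cols = matrixBits α m) (hseen : T.seen = []) :
    Runs writeGadget (rowRegs 0 false) (counters m 0) T (rowRegs 0 false) (counters m 0)
      { T with rows := [], work := (gadgetBits α m).reverse ++ T.work } (gadgetTime m) := by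
  have hloop := runs_forLoop (p := forLoop 1 writeRows) (m := m) (x := 0)
    (b := loopTime m (4 * rowTime m + 7)) (r := rowRegs 0 false) (v := 0) rfl
    (fun t => { T with
      rows := (List.range' t (m - t)).flatMap fun i => (List.range m).map (α i)
      work := ((List.range t).flatMap fun i => (List.range m).flatMap fun j =>
        (List.finRange 4).flatMap fun τ => rowBits α m i j τ).reverse ++ T.work }) ?_
  · refine hloop.congr ?_ ?_ le_rfl
    · ext1 <;> simp [hrows, List.range_eq_range', matrixBits]
    · ext1 <;> simp [gadgetBits]
  · intro i hi
    have := runs_forLoop (p := writeRows) (m := m) (x := 1)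
      (b := 4 * rowTime m + 7) (r := rowRegs 0 false) (v := Function.update 0 0 (i + 1)) (by simp)
      (fun t => { T with
        rows := (List.range' t (m - t)).map (α i) ++
          (List.range' (i + 1) (m - (i + 1))).flatMap fun i => (List.range m).map (α i)
        work := ((List.range t).flatMap fun j =>
            (List.finRange 4).flatMap fun τ => rowBits α m i j τ).reverse ++
          (((List.range i).flatMap fun i => (List.range m).flatMap fun j =>
            (List.finRange 4).flatMap fun τ => rowBits α m i j τ).reverse ++ T.work) }) ?_
    · refine this.congr ?_ ?_ le_rfl
      · ext1 <;> simp [range'_succ_sub hi, List.range_eq_range']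
      · ext1 <;> simp [List.range_succ]
    · intro j hj
      refine (runs_writeRows α m (v := Function.update (Function.update 0 0 (i + 1)) 1 (j + 1))
        hi hj (by simp) (by simp) (by simp) (by simp) _
        ((List.range' (j + 1) (m - (j + 1))).map (α i) ++
        (List.range' (i + 1) (m - (i + 1))).flatMap fun i => (List.range m).map (α i)) ?_
        (by exact hcols) (by exact hseen)).conv rfl rfl ?_ le_rfl
      · simp [range'_succ_sub hj]
      · ext1 <;> simp [List.range_succ]

/-! ### Reading the input and processing a graph -/

/-- Write the order of the gadget graph in unary, closed by a `false`. -/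
def writeOrder : Prog :=
  .seq (forLoop 0 (forLoop 1 (.seq (.push .work fun _ _ => true) (.seq (.push .work fun _ _ => true)
    (.seq (.push .work fun _ _ => true) (.push .work fun _ _ => true))))))
    (.push .work fun _ _ => false)

theorem runs_writeOrder (r : Regs) (T : Tapes) :
    Runs writeOrder r (counters m 0) T r (counters m 0)
      { T with work := (List.replicate (m * m * 4) true ++ [false]).reverse ++ T.work }
      (loopTime m (loopTime m 4) + 1) := by
  have hloop := runs_forLoop (p := forLoop 1 (.seq (.push .work fun _ _ => true)
    (.seq (.push .work fun _ _ => true) (.seq (.push .work fun _ _ => true)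
      (.push .work fun _ _ => true))))) (m := m) (x := 0)
    (b := loopTime m 4) (r := r) (v := 0) rfl
    (fun t => { T with work := List.replicate (t * (m * 4)) true ++ T.work }) ?_
  · refine Runs.conv (Runs.seq (T₂ := { T with
      work := List.replicate (m * (m * 4)) true ++ T.work }) ?_
      (runs_push_work (fun _ => false) _ _ _)) rfl rfl ?_ le_rfl
    · exact hloop.congr (by ext1 <;> simp) rfl le_rfl
    · ext1 <;> simp [mul_assoc]
  · intro i hi
    have := runs_forLoop (p := .seq (.push .work fun _ _ => true)
      (.seq (.push .work fun _ _ => true) (.seq (.push .work fun _ _ => true)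
      (.push .work fun _ _ => true)))) (m := m) (x := 1)
      (b := 4) (r := r) (v := Function.update 0 0 (i + 1)) (by simp)
      (fun t => { T with
        work := List.replicate (t * 4) true ++ (List.replicate (i * (m * 4)) true ++ T.work) }) ?_
    · refine this.congr ?_ ?_ le_rfl
      · ext1 <;> simp
      · ext1 <;> simp [← List.append_assoc]
        ring_nf
    · intro j hj
      refine ((runs_push_work (fun _ => true) _ _ _).seq
        ((runs_push_work (fun _ => true) _ _ _).seq ((runs_push_work (fun _ => true) _ _ _).seq
        (runs_push_work (fun _ => true) _ _ _)))).conv rfl rfl ?_ le_rfl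
      ext1 <;> simp [add_mul, List.replicate_succ]

/-- Read a matrix from the input and store it in reverse, every row extended by two entries
`true`. -/
def readMatrix : Prog :=
  forLoop 0 <| .seq (forLoop 1 (.seq (.pop .inp) (.push .bits fun _ o => o == some true)))
    (.seq (.push .bits fun _ _ => true) (.push .bits fun _ _ => true))

theorem runs_readMatrix (n : ℕ) (r : Regs) (T : Tapes) (rest : List Bool)
    (hinp : T.inp = matrixBits α n ++ rest) :
    Runs readMatrix r (counters n 0) T r (counters n 0)
      { T with
        inp := rest
        bits := ((List.range n).flatMap fun i =>
          (List.range n).map (α i) ++ [true, true]).reverse ++ T.bits }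
      (loopTime n (loopTime n 2 + 2)) := by
  have hloop := runs_forLoop (p := .seq (forLoop 1 (.seq (.pop .inp)
      (.push .bits fun _ o => o == some true)))
      (.seq (.push .bits fun _ _ => true) (.push .bits fun _ _ => true))) (m := n) (x := 0)
    (b := loopTime n 2 + 2) (r := r) (v := 0) rfl
    (fun t => { T with
      inp := ((List.range' t (n - t)).flatMap fun i => (List.range n).map (α i)) ++ rest
      bits := ((List.range t).flatMap fun i =>
        (List.range n).map (α i) ++ [true, true]).reverse ++ T.bits }) ?_
  · refine hloop.congr ?_ ?_ le_rfl
    · ext1 <;> simp [hinp, List.range_eq_range', matrixBits]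
    · ext1 <;> simp
  · intro i hi
    have := runs_forLoop (p := .seq (.pop .inp) (.push .bits fun _ o => o == some true))
      (m := n) (x := 1) (b := 2) (r := r) (v := Function.update 0 0 (i + 1)) (by simp)
      (fun t => { T with
        inp := (List.range' t (n - t)).map (α i) ++
          (((List.range' (i + 1) (n - (i + 1))).flatMap fun i => (List.range n).map (α i)) ++ rest)
        bits := ((List.range t).map (α i)).reverse ++
          (((List.range i).flatMap fun i =>
            (List.range n).map (α i) ++ [true, true]).reverse ++ T.bits) }) ?_
    · refine (this.seq ((runs_push_bits true _ _ _).seq (runs_push_bits true _ _ _))).congr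
        ?_ ?_ le_rfl
      · ext1 <;> simp [range'_succ_sub hi, List.range_eq_range']
      · ext1 <;> simp [List.range_succ]
    · intro j hj o
      refine ⟨some (α i j), ((Exec.pop _ _).seq (Exec.push _ _ _)).conv ?_ le_rfl⟩
      simp [Tapes.str, range'_succ_sub hj, List.range_succ]

/-- Extend the range of all loop variables by one. -/
def incAll : Prog :=
  .seq (.inc (.todo 0)) <| .seq (.inc (.todo 1)) <| .seq (.inc (.todo 2)) (.inc (.todo 3))

theorem runs_incAll (n : ℕ) (r : Regs) (T : Tapes) :
    Runs incAll r (counters n 0) T r (counters (n + 1) 0) T 4 := by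
  refine ((runs_inc _ _ _ _).seq ((runs_inc _ _ _ _).seq ((runs_inc _ _ _ _).seq
    (runs_inc _ _ _ _)))).conv rfl ?_ rfl le_rfl
  funext c
  rcases c with x | x | _ | _
  · simp [counters]
  · fin_cases x <;> simp [counters]
  · simp [counters]
  · simp [counters]

/-- Reduce the range of all loop variables to nothing. -/
def clearAll : Prog :=
  .loop (.todo 0) (.seq (.dec (.todo 1)) (.seq (.dec (.todo 2)) (.dec (.todo 3))))

theorem runs_clearAll (n : ℕ) (r : Regs) (T : Tapes) :
    Runs clearAll r (counters n 0) T r (counters 0 0) T (4 * n + 1) := by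
  induction n with
  | zero => exact fun o => ⟨none, Exec.loop_zero rfl⟩
  | succ n ih =>
    intro o
    obtain ⟨o', h⟩ := ih (some true)
    refine ⟨o', (Exec.loop_succ (n := n) (by simp [counters]) (((Exec.dec _ _).seq
      ((Exec.dec _ _).seq (Exec.dec _ _))).conv ?_ le_rfl) h).mono (by omega)⟩
    congr 1
    funext c
    rcases c with x | x | _ | _
    · simp [counters]
    · fin_cases x <;> simp [counters]
    · simp [counters]
    · simp [counters]

theorem runs_drain_bits (l : List Bool) (r : Regs) (c : Counter → ℕ) (T : Tapes)
    (hT : T.bits = l) :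
    Runs (.drain .bits (.seq (.push .rows fun _ o => o == some true)
      (.push .cols fun _ o => o == some true))) r c T r c
      { T with bits := [], rows := l.reverse ++ T.rows, cols := l.reverse ++ T.cols }
      (3 * l.length + 1) := by
  induction l generalizing T with
  | nil =>
    intro o
    refine ⟨none, (Exec.drain_nil (d := Word.bits) (s := ⟨r, o, c, T.str⟩) hT).conv ?_ (by simp)⟩
    obtain ⟨inp, out, work, bits, rows, cols, seen⟩ := T
    obtain rfl : bits = [] := hT
    rfl
  | cons x l ih =>
    intro o
    obtain ⟨o', h⟩ := ih { T with bits := l, rows := x :: T.rows, cols := x :: T.cols } rfl (some x)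
    refine ⟨o', (Exec.drain_cons (d := Word.bits) (x := x) (l := l) (s₁ := ⟨r, o, c, T.str⟩) hT
      (((Exec.push _ _ _).seq (Exec.push _ _ _)).conv (s'' := ⟨r, some x, c,
        { T with bits := l, rows := x :: T.rows, cols := x :: T.cols }.str⟩) ?_ le_rfl) h).conv
      ?_ ?_⟩
    · simp [Tapes.str]
    · simp
    · simp; omega

theorem runs_drain_cols (l : List Bool) (r : Regs) (c : Counter → ℕ) (T : Tapes)
    (hT : T.cols = l) :
    Runs (.drain .cols (.load fun r _ => r)) r c T r c { T with cols := [] }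
      (2 * l.length + 1) := by
  induction l generalizing T with
  | nil =>
    intro o
    refine ⟨none, (Exec.drain_nil (d := Word.cols) (s := ⟨r, o, c, T.str⟩) hT).conv ?_ (by simp)⟩
    obtain ⟨inp, out, work, bits, rows, cols, seen⟩ := T
    obtain rfl : cols = [] := hT
    rfl
  | cons x l ih =>
    intro o
    obtain ⟨o', h⟩ := ih { T with cols := l } rfl (some x)
    refine ⟨o', (Exec.drain_cons (d := Word.cols) (x := x) (l := l) (s₁ := ⟨r, o, c, T.str⟩) hT
      ((Exec.load _ _).conv (s'' := ⟨r, some x, c, { T with cols := l }.str⟩) ?_ le_rfl) h).conv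
      ?_ ?_⟩
    · simp
    · simp
    · simp; omega


end Output

/-- Translate a graph whose order has been read into the ranges of the loop variables: read its
matrix, pad it with two rows and columns of entries `true`, make a copy of it for the rows and one
for the columns of the output, and write the code of the gadget graph, in reverse. -/
def processGraph : Prog :=
  .seq readMatrix <| .seq incAll <| .seq incAll <|
  .seq (forLoop 1 (.seq (.push .bits fun _ _ => true) (.push .bits fun _ _ => true))) <|
  .seq (.drain .bits (.seq (.push .rows fun _ o => o == some true)
    (.push .cols fun _ o => o == some true))) <|
  .seq writeOrder <| .seq writeGadget <| .seq (.drain .cols (.load fun r _ => r)) clearAll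

/-- Padding in terms of the bit string. -/
theorem matrixBits_add_two {α : ℕ → ℕ → Bool} {n : ℕ}
    (hα : ∀ i j, n ≤ i ∨ n ≤ j → α i j = true) :
    matrixBits α (n + 2) = ((List.range n).flatMap fun i =>
      (List.range n).map (α i) ++ [true, true]) ++ List.replicate ((n + 2) * 2) true := by
  have h1 : ∀ i, n ≤ i → (List.range (n + 2)).map (α i) = List.replicate (n + 2) true := by
    intro i hi
    rw [List.eq_replicate_iff]
    simp [hα i _ (Or.inl hi)]
  have h2 : ∀ i, (List.range (n + 2)).map (α i) = (List.range n).map (α i) ++ [true, true] := by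
    intro i
    simp [List.range_succ, hα i _ (Or.inr le_rfl), hα i _ (Or.inr (Nat.le_succ n))]
  have h3 : List.range (n + 2) = List.range n ++ [n, n + 1] := by simp [List.range_succ]
  unfold matrixBits
  rw [h3, List.flatMap_append, ← h3]
  congr 1
  · simp only [h2]
  · simp [h1 n le_rfl, h1 (n + 1) (Nat.le_succ n), mul_two]

/-- The time to process a graph. -/
def processTime {S : Type*} [CommSemiring S] (n : S) : S :=
  loopTime n (loopTime n 2 + 2) + 8 + loopTime (n + 2) 2 + (3 * ((n + 2) * (n + 2)) + 1) +
    (loopTime (n + 2) (loopTime (n + 2) 4) + 1) + gadgetTime (n + 2) +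
    (2 * ((n + 2) * (n + 2)) + 1) + (4 * (n + 2) + 1)

/-- The code of the gadget graph. -/
def gadgetCode (α : ℕ → ℕ → Bool) (m : ℕ) : List Bool :=
  List.replicate (m * m * 4) true ++ false :: gadgetBits α m

theorem runs_processGraph {α : ℕ → ℕ → Bool} {n : ℕ}
    (hα : ∀ i j, n ≤ i ∨ n ≤ j → α i j = true) (rest work : List Bool) :
    Runs processGraph (rowRegs 0 false) (counters n 0)
      ⟨matrixBits α n ++ rest, [], work, [], [], [], []⟩
      (rowRegs 0 false) (counters 0 0)
      ⟨rest, [], (gadgetCode α (n + 2)).reverse ++ work, [], [], [], []⟩ (processTime n) := by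
  have hpad := runs_forLoop (p := .seq (.push .bits fun _ _ => true) (.push .bits fun _ _ => true))
    (m := n + 2) (x := 1) (b := 2) (r := rowRegs 0 false) (v := 0) rfl
    (fun t => ⟨rest, [], work, List.replicate (t * 2) true ++ ((List.range n).flatMap fun i =>
          (List.range n).map (α i) ++ [true, true]).reverse, [], [], []⟩) (fun t _ =>
      ((runs_push_bits true _ _ _).seq (runs_push_bits true _ _ _)).conv rfl rfl
        (by ext1 <;> simp [add_mul, List.replicate_succ]) le_rfl)
  replace hpad := hpad.congr (S := ⟨rest, [], work, ((List.range n).flatMap fun i =>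
          (List.range n).map (α i) ++ [true, true]).reverse, [], [], []⟩)
    (S' := ⟨rest, [], work, (matrixBits α (n + 2)).reverse, [], [], []⟩) (by simp)
    (by rw [matrixBits_add_two hα]; simp) le_rfl
  have hread := (runs_readMatrix α n (rowRegs 0 false)
    ⟨matrixBits α n ++ rest, [], work, [], [], [], []⟩ rest rfl).conv
    (T'' := ⟨rest, [], work, ((List.range n).flatMap fun i =>
          (List.range n).map (α i) ++ [true, true]).reverse, [], [], []⟩) rfl rfl (by simp) le_rfl
  have hspread := (runs_drain_bits _ (rowRegs 0 false) (counters (n + 2) 0)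
    ⟨rest, [], work, (matrixBits α (n + 2)).reverse, [], [], []⟩ rfl).conv
    (T'' := ⟨rest, [], work, [], matrixBits α (n + 2), matrixBits α (n + 2), []⟩)
    rfl rfl (by simp) le_rfl
  refine (hread.seq ((runs_incAll _ _ _).seq ((runs_incAll _ _ _).seq (hpad.seq (hspread.seq
    ((runs_writeOrder _ _ _).seq ((runs_writeGadget α (n + 2) _ rfl rfl rfl).seq
    ((runs_drain_cols _ _ _ _ rfl).seq (runs_clearAll _ _ _))))))))).conv rfl rfl ?_ ?_
  · simp [gadgetCode]
  · simp only [processTime, List.length_reverse, length_matrixBits]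
    omega

/-- Translate the graphs in the input one after the other: the bits `true` of the order are counted,
and the `false` after them starts the translation. -/
def readGraphs : Prog := .drain .inp (.ite (fun o => o == some true) incAll processGraph)

theorem exec_readGraphs {α : ℕ → ℕ → Bool} {n b : ℕ}
    (hα : ∀ i j, n ≤ i ∨ n ≤ j → α i j = true) (rest work : List Bool)
    (s : ProgState Counter Word Regs)
    (h : ∀ o, Exec readGraphs ⟨rowRegs 0 false, o, counters 0 0, Tapes.str
      ⟨rest, [], (gadgetCode α (n + 2)).reverse ++ work, [], [], [], []⟩⟩ s b) (o : Option Bool) :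
    Exec readGraphs ⟨rowRegs 0 false, o, counters 0 0, Tapes.str
      ⟨List.replicate n true ++ false :: (matrixBits α n ++ rest), [], work, [], [], [], []⟩⟩ s
      (6 * n + processTime n + 2 + b) := by
  have key : ∀ k t, t + k = n → ∀ o, Exec readGraphs ⟨rowRegs 0 false, o, counters t 0, Tapes.str
      ⟨List.replicate k true ++ false :: (matrixBits α n ++ rest), [], work, [], [], [], []⟩⟩ s
      (6 * k + processTime n + 2 + b) := by
    intro k
    induction k with
    | zero =>
      intro t ht o
      obtain rfl : t = n := ht
      obtain ⟨o', h'⟩ := runs_processGraph hα rest work (some false)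
      refine (Exec.drain_cons (d := Word.inp) rfl (Exec.ite_false rfl ?_) (h o')).mono
        (b := processTime t + 1 + b + 1) (by omega)
      convert h' using 2
      simp
    | succ k ih =>
      intro t ht o
      obtain ⟨o', h'⟩ := runs_incAll t (rowRegs 0 false) ⟨List.replicate k true ++
        false :: (matrixBits α n ++ rest), [], work, [], [], [], []⟩ (some true)
      refine (Exec.drain_cons (d := Word.inp) rfl (Exec.ite_true rfl ?_)
        (ih (t + 1) (by omega) o')).mono
        (b := 4 + 1 + (6 * k + processTime n + 2 + b) + 1) (by omega)
      convert h' using 2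
      simp
  exact key n 0 (by omega) o

theorem runs_drain_work (l : List Bool) (r : Regs) (o : Option Bool) (c : Counter → ℕ) (T : Tapes)
    (hT : T.work = l) :
    Exec (.drain .work (.push .out fun _ o => o == some true)) ⟨r, o, c, T.str⟩
      ⟨r, none, c, { T with work := [], out := l.reverse ++ T.out }.str⟩
      (2 * l.length + 1) := by
  induction l generalizing T o with
  | nil =>
    refine (Exec.drain_nil (d := Word.work) (s := ⟨r, o, c, T.str⟩) hT).conv ?_ (by simp)
    obtain ⟨inp, out, work, bits, rows, cols, seen⟩ := T
    obtain rfl : work = [] := hT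
    rfl
  | cons x l ih =>
    refine (Exec.drain_cons (d := Word.work) (x := x) (l := l) (s₁ := ⟨r, o, c, T.str⟩) hT
      ((Exec.push _ _ _).conv (s'' := ⟨r, some x, c,
        { T with work := l, out := x :: T.out }.str⟩) ?_ le_rfl)
      (ih (some x) { T with work := l, out := x :: T.out } rfl)).conv ?_ ?_
    · simp [Tapes.str]
    · simp
    · simp; omega

/-- The program of the reduction. -/
def reduction : Prog :=
  .seq readGraphs (.drain .work (.push .out fun _ o => o == some true))

theorem length_gadgetCode (α : ℕ → ℕ → Bool) (m : ℕ) :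
    (gadgetCode α m).length = m * m * 4 + 1 + (m * m * 4) * (m * m * 4) := by
  simp [gadgetCode, gadgetBits, rowBits, cellBits, List.length_flatMap]
  ring

/-- The running time of the reduction for graphs of order at most `n`. -/
def reductionTime {S : Type*} [CommSemiring S] (n : S) : S :=
  2 * (6 * n + processTime n + 2) + 1 + (2 * (2 * ((n + 2) * (n + 2) * 4 + 1 +
    ((n + 2) * (n + 2) * 4) * ((n + 2) * (n + 2) * 4))) + 1)

theorem eval_reductionTime (n : ℕ) :
    (reductionTime (Polynomial.X : Polynomial ℕ)).eval n = reductionTime n := by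
  simp [reductionTime, processTime, gadgetTime, rowTime, loopTime]

theorem reductionTime_bound {n n' l : ℕ} (h : n ≤ l) (h' : n' ≤ l) :
    (6 * n + processTime n + 2) + ((6 * n' + processTime n' + 2) + 1) +
      (2 * (((n + 2) * (n + 2) * 4 + 1 + ((n + 2) * (n + 2) * 4) * ((n + 2) * (n + 2) * 4)) +
        ((n' + 2) * (n' + 2) * 4 + 1 + ((n' + 2) * (n' + 2) * 4) * ((n' + 2) * (n' + 2) * 4))) + 1)
      ≤ reductionTime l := by
  have hp : ∀ {k : ℕ}, k ≤ l → 6 * k + processTime k + 2 ≤ 6 * l + processTime l + 2 := by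
    intro k hk
    unfold processTime gadgetTime rowTime loopTime
    gcongr
  have hs : ∀ {k : ℕ}, k ≤ l →
      (k + 2) * (k + 2) * 4 + 1 + ((k + 2) * (k + 2) * 4) * ((k + 2) * (k + 2) * 4) ≤
      (l + 2) * (l + 2) * 4 + 1 + ((l + 2) * (l + 2) * 4) * ((l + 2) * (l + 2) * 4) := by
    intro k hk
    gcongr
  have := hp h
  have := hp h'
  have := hs h
  have := hs h'
  unfold reductionTime
  omega

theorem exec_reduction {α α' : ℕ → ℕ → Bool} {n n' l : ℕ}
    (hα : ∀ i j, n ≤ i ∨ n ≤ j → α i j = true) (hα' : ∀ i j, n' ≤ i ∨ n' ≤ j → α' i j = true)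
    (hn : n ≤ l) (hn' : n' ≤ l) :
    Exec reduction ⟨rowRegs 0 false, none, fun _ => 0, Function.update (fun _ => []) .inp
      ((List.replicate n true ++ false :: matrixBits α n) ++
        (List.replicate n' true ++ false :: matrixBits α' n'))⟩
      ⟨rowRegs 0 false, none, fun _ => 0, Function.update (fun _ => []) .out
        (gadgetCode α (n + 2) ++ gadgetCode α' (n' + 2))⟩
      ((reductionTime (Polynomial.X : Polynomial ℕ)).eval l) := by
  have hcnt : (fun _ => 0) = counters 0 0 := by funext c; cases c <;> rfl
  have hempty : (fun _ => []) = Tapes.str ⟨[], [], [], [], [], [], []⟩ := by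
    funext c; cases c <;> rfl
  rw [hcnt, hempty, update_inp, update_out]
  have h1 := exec_readGraphs hα (List.replicate n' true ++ false :: matrixBits α' n') []
    ⟨rowRegs 0 false, none, counters 0 0, Tapes.str ⟨[], [], (gadgetCode α' (n' + 2)).reverse ++
      ((gadgetCode α (n + 2)).reverse ++ []), [], [], [], []⟩⟩
    (b := 6 * n' + processTime n' + 2 + 1) (fun o => by
      have := exec_readGraphs hα' [] ((gadgetCode α (n + 2)).reverse ++ [])
        ⟨rowRegs 0 false, none, counters 0 0, Tapes.str ⟨[], [], (gadgetCode α' (n' + 2)).reverse ++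
          ((gadgetCode α (n + 2)).reverse ++ []), [], [], [], []⟩⟩
        (fun o => (Exec.drain_nil (d := Word.inp) (s := ⟨rowRegs 0 false, o, counters 0 0, _⟩)
          rfl)) o
      simpa using this) none
  refine Exec.conv (Exec.seq (by simpa using h1) (runs_drain_work _ _ _ _ _ rfl)) (by simp) ?_
  rw [eval_reductionTime]
  refine le_trans (le_of_eq ?_) (reductionTime_bound hn hn')
  simp [length_gadgetCode]
  ring


/-! ### The gadget graph of a finite graph -/

open scoped Classical in
/-- The adjacency matrix of `G`, extended by entries `true` outside of the range of the
vertices. -/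
noncomputable def entry (G : FinGraph) (i j : ℕ) : Bool :=
  if h : i < G.order ∧ j < G.order then decide (G.graph.Adj ⟨i, h.1⟩ ⟨j, h.2⟩) else true

theorem entry_val (G : FinGraph) (i j : Fin G.order) :
    entry G i j = true ↔ G.graph.Adj i j := by
  simp [entry]

theorem entry_eq_true (G : FinGraph) (i j : ℕ) (h : G.order ≤ i ∨ G.order ≤ j) :
    entry G i j = true := by
  unfold entry
  rw [dif_neg (by omega)]

theorem entry_comm (G : FinGraph) (i j : ℕ) : entry G i j = entry G j i := by
  unfold entry
  by_cases h : i < G.order ∧ j < G.order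
  · rw [dif_pos h, dif_pos h.symm, decide_eq_decide]
    exact G.graph.adj_comm _ _
  · rw [dif_neg h, dif_neg fun h' => h h'.symm]

/-- The matrix of `G` with two additional indices, whose rows and columns consist of entries
`true`. The additional indices make interval dimension `2` and height `3` hold for every `G`, even
the empty one. Their diagonal entries `true` tell them from the vertices of `G`. -/
noncomputable def matrix (G : FinGraph) (i j : Fin (G.order + 2)) : Bool := entry G i j

theorem encode_eq (G : FinGraph) :
    G.encode = List.replicate G.order true ++ false :: matrixBits (entry G) G.order := by
  unfold FinGraph.encode matrixBits
  congr 2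
  rw [← List.map_coe_finRange_eq_range, List.flatMap_map]
  congr 1
  funext i
  rw [List.map_map]
  congr 1
  funext j
  rw [Bool.eq_iff_iff]
  simp [entry_val]

theorem finRange_mul (a b : ℕ) : List.finRange (a * b) =
    (List.finRange a).flatMap fun i => (List.finRange b).map fun j => finProdFinEquiv (i, j) := by
  rw [← List.ofFn_id, List.ofFn_mul]
  simp only [List.ofFn_eq_map, List.flatMap, id]
  congr 2
  funext i
  congr 1
  funext j
  ext
  simp [finProdFinEquiv, mul_comm, add_comm]

/-- The numbering of the vertices of the gadget graph. -/
def vertexEquiv (m : ℕ) : Fin m × Fin m × Fin 4 ≃ Fin (m * (m * 4)) :=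
  ((Equiv.refl _).prodCongr finProdFinEquiv).trans finProdFinEquiv

theorem finRange_vertexEquiv (m : ℕ) : List.finRange (m * (m * 4)) =
    (List.finRange m).flatMap fun i => (List.finRange m).flatMap fun j =>
      (List.finRange 4).map fun τ => vertexEquiv m (i, j, τ) := by
  rw [finRange_mul, finRange_mul]
  simp [List.map_flatMap, vertexEquiv, Function.comp_def]

/-- The gadget graph of `G` as a graph on an initial segment of the natural numbers. -/
noncomputable def gadget (G : FinGraph) : FinGraph where
  order := (G.order + 2) * ((G.order + 2) * 4)
  graph := (gadgetGraph (matrix G)).comap (vertexEquiv (G.order + 2)).symm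

noncomputable def gadgetIso (G : FinGraph) : (gadget G).graph ≃g gadgetGraph (matrix G) :=
  SimpleGraph.Iso.comap (vertexEquiv (G.order + 2)).symm _

theorem encode_gadget (G : FinGraph) :
    (gadget G).encode = gadgetCode (entry G) (G.order + 2) := by
  unfold FinGraph.encode gadgetCode
  simp only [gadget, mul_assoc]
  congr 2
  simp only [finRange_vertexEquiv, gadgetBits, rowBits, cellBits,
    ← List.map_coe_finRange_eq_range, List.flatMap_map, List.flatMap_assoc, List.map_flatMap,
    List.map_map]
  congr 1; funext i
  congr 1; funext j
  congr 1; funext τ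
  congr 1; funext k
  congr 1; funext l
  congr 1; funext τ'
  simp [gadgetGraph, gadgetAdj, matrix, Fin.ext_iff]

theorem isComparabilityGraph_gadget (G : FinGraph) :
    IsComparabilityGraphOfDimHeight 2 3 (gadget G) :=
  ⟨_, inferInstance, gadgetOrder (matrix G) id,
    intervalDimension_gadgetOrder _ Function.injective_id,
    posetHeight_gadgetOrder _ Function.injective_id, ⟨by
      rw [comparabilityGraph_gadgetOrder _ Function.injective_id]
      exact gadgetIso G⟩⟩

theorem matrix_castAdd (G : FinGraph) (i j : Fin G.order) :
    matrix G (Fin.castAdd 2 i) (Fin.castAdd 2 j) = true ↔ G.graph.Adj i j :=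
  entry_val G i j

/-- An isomorphism extends to the additional indices by the identity. -/
theorem nonempty_iso_gadget (G H : FinGraph) (e : G.graph ≃g H.graph) :
    Nonempty ((gadget G).graph ≃g (gadget H).graph) := by
  let ε : Fin (G.order + 2) ≃ Fin (H.order + 2) :=
    finSumFinEquiv.symm.trans ((e.toEquiv.sumCongr (Equiv.refl (Fin 2))).trans finSumFinEquiv)
  refine ⟨(gadgetIso G).trans ((gadgetGraphIso ε ?_).trans (gadgetIso H).symm)⟩
  intro u v
  obtain ⟨u, rfl⟩ := finSumFinEquiv.surjective u
  obtain ⟨v, rfl⟩ := finSumFinEquiv.surjective v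
  simp only [ε, Equiv.trans_apply, Equiv.symm_apply_apply]
  rcases u with u | u <;> rcases v with v | v
  · simp only [Equiv.sumCongr_apply, Sum.map_inl, finSumFinEquiv_apply_left]
    rw [Bool.eq_iff_iff, matrix_castAdd, matrix_castAdd]
    exact e.map_adj_iff
  all_goals
    simp only [Equiv.sumCongr_apply, Sum.map_inl, Sum.map_inr, finSumFinEquiv_apply_left,
      finSumFinEquiv_apply_right]
    rw [matrix, matrix, entry_eq_true, entry_eq_true] <;> simp

/-- An isomorphism of the gadget graphs induces an embedding of `G` into `H`, as the vertices of `G`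
and `H` are the indices with diagonal entry `false`; it is bijective because the orders agree. -/
theorem nonempty_iso_of_gadget (G H : FinGraph) (e : (gadget G).graph ≃g (gadget H).graph) :
    Nonempty (G.graph ≃g H.graph) := by
  let φ : gadgetGraph (matrix G) ≃g gadgetGraph (matrix H) :=
    (gadgetIso G).symm.trans (e.trans (gadgetIso H))
  obtain ⟨σ, hσ, hσ'⟩ := exists_of_gadgetGraph_iso (A := matrix G) (B := matrix H)
    (fun i j => entry_comm G i j)
    (fun i j => entry_comm H i j) φ
  have hdiag : ∀ i : Fin G.order, matrix G (Fin.castAdd 2 i) (Fin.castAdd 2 i) = false := by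
    intro i
    rw [← Bool.not_eq_true, matrix_castAdd]
    exact G.graph.irrefl
  have hlt : ∀ i : Fin G.order, (σ (Fin.castAdd 2 i) : ℕ) < H.order := by
    intro i
    by_contra h
    have := hσ _ (hdiag i)
    rw [matrix, entry_eq_true _ _ _ (Or.inl (not_lt.1 h))] at this
    exact absurd this (by simp)
  have hcard : G.order = H.order := by
    have h := Fintype.card_congr e.toEquiv
    rw [Fintype.card_fin, Fintype.card_fin] at h
    change (G.order + 2) * ((G.order + 2) * 4) = (H.order + 2) * ((H.order + 2) * 4) at h
    nlinarith
  let g : Fin G.order → Fin H.order := fun i => ⟨_, hlt i⟩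
  have hg : Function.Injective g := fun i j hij =>
    Fin.castAdd_injective _ _ ((hσ' _ _ (hdiag i) (hdiag j)).1
      (Fin.ext (Fin.mk.inj hij)))
  have hbij : Function.Bijective g :=
    (Fintype.bijective_iff_injective_and_card g).2 ⟨hg, by simpa using hcard⟩
  refine ⟨⟨Equiv.ofBijective g hbij, fun {i j} => ?_⟩⟩
  rw [← matrix_castAdd, ← matrix_castAdd, (hσ' _ _ (hdiag i) (hdiag j)).2]
  rfl

theorem order_le_length_encode (G : FinGraph) : G.order ≤ G.encode.length := by
  simp [FinGraph.encode]

end Reduction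

open Reduction in
/-- The graph isomorphism problem is GI-complete for comparability graphs of posets with interval
dimension `2` and height `3`. -/
theorem theorem1 : GIComplete (IsComparabilityGraphOfDimHeight 2 3) := by
  constructor
  · refine ⟨fun p => (⟨p.1.1, trivial⟩, ⟨p.2.1, trivial⟩), ⟨?_⟩, fun p => Iff.rfl⟩
    exact
      { tm := Turing.idComputer Bool
        inputAlphabet := Equiv.refl Bool
        outputAlphabet := Equiv.refl Bool
        time := 1
        outputsFun := fun p =>
          { steps := 1
            evals_in_steps := rfl
            steps_le_m := by simp } }
  · refine ⟨fun p => (⟨gadget p.1.1, isComparabilityGraph_gadget _⟩,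
      ⟨gadget p.2.1, isComparabilityGraph_gadget _⟩), ?_, fun p => ?_⟩
    · refine StackProg.polyTime_of_exec reduction .inp .out (rowRegs 0 false)
        (reductionTime Polynomial.X) fun p => ?_
      have h := exec_reduction (entry_eq_true p.1.1) (entry_eq_true p.2.1)
        (l := (p.1.1.encode ++ p.2.1.encode).length)
        ((order_le_length_encode _).trans (by simp)) ((order_le_length_encode _).trans (by simp))
      rw [← encode_eq, ← encode_eq, ← encode_gadget, ← encode_gadget] at h
      exact h
    · exact ⟨fun ⟨e⟩ => nonempty_iso_gadget _ _ e, fun ⟨e⟩ => nonempty_iso_of_gadget _ _ e⟩
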